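/- Let $n,k,l,q$ be integers with $0\le l\le k$, $q\ge 1$ and $k<n-q$. Let $Cl_n$ be the real Clifford algebra generated by the standard basis $e_1,\dots,e_n$ of $\mathbb R^n$ with $e_ie_j+e_je_i=-2\delta_{ij}$, so that $\mathbb R^n\subset Cl_n$, and let $D=\sum_{j=1}^n e_j\,\partial/\partial x_j$ be the Dirac operator acting from the left on $Cl_n$-valued functions. Let $\omega_n$ be the surface area of the unit sphere of $\mathbb R^n$. For $1\le p\le n-1$ let $G_p$ be the fundamental solution of $D^p$ $$G_p(x)=-c_p\,\frac{x}{\|x\|^{\,n-p+1}}\ \ (p\text{ odd}),\qquad G_p(x)=\frac{c_p}{\|x\|^{\,n-p}}\ \ (p\text{ even}),$$ with $c_1=1$, $c_p=c_{p-1}/(n-p)$ for $p$ even and $c_p=c_{p-1}/(p-1)$ for $p\ge 3$ odd (so that $DG_1=\omega_n\delta_0$ and $DG_{p+1}=G_p$). Identify $\mathbb Z^k$ with $\mathbb Ze_1+\dots+\mathbb Ze_k\subset\mathbb R^n$, let $C_k=\mathbb R^n/\mathbb Z^k$ be the $k$-cylinder with projection $p_k:\mathbb R^n\to C_k$, and let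 $E^{(l)}$ be the spinor bundle over $C_k$ obtained from $\mathbb R^n\times Cl_n$ by identifying $(x,X)$ with $(x+m,(-1)^{m_1+\dots+m_l}X)$ for all $m\in\mathbb Z^k$. For $1\le p\le q$ put $$\cot_{p,k,l}(x,y)=\sum_{m\in\mathbb Z^k}(-1)^{m_1+\dots+m_l}\,G_p(x-y+m).$$ Let $V'\subset C_k$ be open, $V=p_k^{-1}(V')$, and let $f'$ be a section of $E^{(l)}$ over $V'$, of class $C^q$, that is left Clifford holomorphic of order $q$. That is, its lift $f:V\to Cl_n$, defined by $f'(p_k(x))=[(x,f(x))]$ and hence satisfying $f(x+m)=(-1)^{m_1+\dots+m_l}f(x)$ for $m\in\mathbb Z^k$, is of class $C^q$ with $D^qf=0$ on $V$. Let $W$ be a bounded open set with Lipschitz boundary $S=\partial W$ and $\overline W\subset V$, such that for $x\in W$ and $m\in\mathbb Z^k\setminus\{0\}$ the point $x+m$ is not in $W$. Let $n(x)$ be the outer unit normal to $S$ (defined almost everywhere) and $\sigma$ the surface measure on $S$. Then for every $y\in W$ the series $\cot_{j+1,k,l}(x,y)$, $0\le j\le q-1$, converge absolutely for every $x\in S$,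 the integrand below is integrable on $S$, and $$f(y)=\frac1{\omega_n}\int_S\ \sum_{j=0}^{q-1}(-1)^j\,\cot_{j+1,k,l}(x,y)\,n(x)\,D^jf(x)\,d\sigma(x).$$ The case $q=1$ is a Cauchy integral formula and the case $q=2$ is a Green's formula. -/

import Mathlib

open MeasureTheory Topology

noncomputable section

namespace CliffordCylinder

/-- Euclidean space `ℝⁿ`. -/
abbrev E (n : ℕ) : Type := EuclideanSpace ℝ (Fin n)

/-- The standard basis vector `e_j` of `ℝⁿ`. -/
abbrev e (n : ℕ) (j : Fin n) : E n := EuclideanSpace.single j (1 : ℝ)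

/-! ### The Clifford algebra and its norm -/

/-- The quadratic form `x ↦ -‖x‖²` on `ℝⁿ`. -/
def cliffordForm (n : ℕ) : QuadraticForm ℝ (E n) :=
  -(LinearMap.BilinMap.toQuadraticMap (innerₗ (E n)))

/-- The real Clifford algebra `Cl_n`, in which `e_i e_j + e_j e_i = -2 δ_ij`. -/
abbrev Cl (n : ℕ) : Type := CliffordAlgebra (cliffordForm n)

/-- A vector of `ℝⁿ` seen as an element of `Cl_n`. -/
abbrev vec {n : ℕ} (x : E n) : Cl n := CliffordAlgebra.ι (cliffordForm n) x

/-- The basis of `Cl_n` indexed by the subsets of `{1, …, n}`. -/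
def clBasis (n : ℕ) : Module.Basis (Finset (Fin n)) ℝ (Cl n) :=
  (Module.Basis.ExteriorAlgebra (EuclideanSpace.basisFun (Fin n) ℝ).toBasis).map
    (CliffordAlgebra.equivExterior (cliffordForm n)).symm

instance (n : ℕ) : FiniteDimensional ℝ (Cl n) := (clBasis n).finiteDimensional_of_finite

/-- The coordinates of an element of `Cl_n`. -/
def clCoord (n : ℕ) : Cl n →ₗ[ℝ] EuclideanSpace ℝ (Finset (Fin n)) :=
  (WithLp.linearEquiv 2 ℝ (Finset (Fin n) → ℝ)).symm.toLinearMap ∘ₗ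
    (clBasis n).equivFun.toLinearMap

theorem clCoord_injective (n : ℕ) : Function.Injective (clCoord n) :=
  (WithLp.linearEquiv 2 ℝ (Finset (Fin n) → ℝ)).symm.injective.comp
    (clBasis n).equivFun.injective

/-- The Euclidean norm of the coordinates. It is used only for differentiation, integration and
summation, for which all norms on the finite-dimensional space `Cl_n` are equivalent. -/
instance (n : ℕ) : NormedAddCommGroup (Cl n) :=
  NormedAddCommGroup.induced (Cl n) (EuclideanSpace ℝ (Finset (Fin n))) (clCoord n)
    (clCoord_injective n)

instance (n : ℕ) : NormedSpace ℝ (Cl n) :=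
  NormedSpace.induced ℝ (Cl n) (EuclideanSpace ℝ (Finset (Fin n))) (clCoord n)

/-- The Euclidean Dirac operator acting from the left, `D f = ∑ⱼ e_j ∂f/∂x_j`. Its powers are
the iterates `(dirac n)^[q]`. -/
def dirac (n : ℕ) (f : E n → Cl n) : E n → Cl n :=
  fun x => ∑ j : Fin n, vec (e n j) * fderiv ℝ f x (e n j)

/-! ### The fundamental solutions -/

/-- Positive constants `c_1 = 1`, `c_k = c_{k-1} / (n - k)` for `k` even and
`c_k = c_{k-1} / (k - 1)` for `k ≥ 3` odd. -/
def fundCoeff (n : ℕ) : ℕ → ℝ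
  | 0 => 1
  | 1 => 1
  | k + 2 => fundCoeff n (k + 1) / (if Even k then (n : ℝ) - ((k : ℝ) + 2) else (k : ℝ) + 1)

/-- The fundamental solution `G_k` of `D^k` (`1 ≤ k ≤ n - 1`):
`G_k(x) = -c_k x / ‖x‖^(n-k+1)` for `k` odd and `G_k(x) = c_k / ‖x‖^(n-k)` for `k` even. The sign
and the constants are those for which `D G_1 = ω_n δ_0` and `D G_(k+1) = G_k`. -/
def G (n k : ℕ) (x : E n) : Cl n :=
  if Even k then algebraMap ℝ (Cl n) (fundCoeff n k * ‖x‖ ^ ((k : ℤ) - (n : ℤ)))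
  else -(fundCoeff n k * ‖x‖ ^ ((k : ℤ) - (n : ℤ) - 1)) • vec x

/-! ### The lattice, the cylinder and the spinor bundles -/

/-- The lattice vector `m_1 e_1 + ⋯ + m_k e_k` of `ℝⁿ` (for `k ≤ n`). -/
def latticeVec (n k : ℕ) : (Fin k → ℤ) →+ E n where
  toFun m := WithLp.toLp 2 fun i => if h : i.val < k then (m ⟨i.val, h⟩ : ℝ) else 0
  map_zero' := by ext i; simp
  map_add' a b := by
    ext i
    by_cases h : i.val < k <;> simp [h]

/-- The `k`-cylinder `C_k = ℝⁿ / ℤᵏ`. -/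
abbrev Cylinder (n k : ℕ) : Type := E n ⧸ (latticeVec n k).range

/-- The sign `(-1)^(m_1 + ⋯ + m_l)`. -/
def sign (k l : ℕ) (m : Fin k → ℤ) : ℝ := (-1 : ℝ) ^ (∑ i : Fin k with i.val < l, m i)

theorem sign_zero (k l : ℕ) : sign k l 0 = 1 := by simp [sign]

theorem sign_add (k l : ℕ) (a b : Fin k → ℤ) : sign k l (a + b) = sign k l a * sign k l b := by
  simp [sign, Finset.sum_add_distrib, zpow_add₀]

/-- The identification of `(x, X)` with `(x + m, (-1)^(m_1 + ⋯ + m_l) X)` for `m ∈ ℤᵏ`. -/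
def bundleSetoid (n k l : ℕ) : Setoid (E n × Cl n) where
  r a b := ∃ m : Fin k → ℤ, b.1 = a.1 + latticeVec n k m ∧ b.2 = sign k l m • a.2
  iseqv :=
    { refl := fun a => ⟨0, by simp, by simp [sign_zero]⟩
      symm := by
        rintro a b ⟨m, h1, h2⟩
        refine ⟨-m, by simp [h1], ?_⟩
        rw [h2, smul_smul, ← sign_add]
        simp [sign_zero]
      trans := by
        rintro a b c ⟨m, h1, h2⟩ ⟨m', h1', h2'⟩
        refine ⟨m + m', by simp [h1', h1, add_assoc], ?_⟩
        rw [h2', h2, smul_smul, ← sign_add, add_comm] }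

/-- The total space of the spinor bundle `E^(l)` over `C_k`. -/
def SpinorBundle (n k l : ℕ) : Type := Quotient (bundleSetoid n k l)

/-- The class of `(x, X)` in `E^(l)`, a point of the fibre over the class of `x`. -/
def SpinorBundle.mk (n k l : ℕ) (x : E n) (X : Cl n) : SpinorBundle n k l :=
  Quotient.mk (bundleSetoid n k l) (x, X)

/-- The inverse image `V ⊆ ℝⁿ` of `V' ⊆ C_k` under the projection `ℝⁿ → C_k`. -/
def cover (n k : ℕ) (V' : Set (Cylinder n k)) : Set (E n) :=
  {x | (QuotientAddGroup.mk x : Cylinder n k) ∈ V'}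

/-- `f : V → Cl_n` is a lift of the section `s : V' → E^(l)`, that is, `s(x') = [(x, f(x))]`. -/
def IsLift (n k l : ℕ) (V' : Set (Cylinder n k)) (s : V' → SpinorBundle n k l)
    (f : E n → Cl n) : Prop :=
  ∀ (x : E n) (hx : (QuotientAddGroup.mk x : Cylinder n k) ∈ V'),
    s ⟨QuotientAddGroup.mk x, hx⟩ = SpinorBundle.mk n k l x (f x)

/-- `s : V' → E^(l)` is a left Clifford holomorphic section of order `q`: a section of class `C^q`
with `D_l^q s = 0`, where `D_l^q` is the operator induced on sections by `D^q`. -/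
def IsCliffordHolomorphicSection (n k l q : ℕ) (V' : Set (Cylinder n k))
    (s : V' → SpinorBundle n k l) : Prop :=
  ∃ f : E n → Cl n, IsLift n k l V' s f ∧ ContDiffOn ℝ q f (cover n k V') ∧
    ∀ x ∈ cover n k V', (dirac n)^[q] f x = 0

/-! ### The cotangent kernels -/

/-- The term of index `m` of the series `cot_{q,k,l}(x, y)`. -/
def cotTerm (n q k l : ℕ) (x y : E n) (m : Fin k → ℤ) : Cl n :=
  sign k l m • G n q (x - y + latticeVec n k m)

/-- The cotangent kernel
`cot_{q,k,l}(x, y) = ∑_{m ∈ ℤᵏ} (-1)^(m_1 + ⋯ + m_l) G_q(x - y + m)`. -/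
def cot (n q k l : ℕ) (x y : E n) : Cl n := ∑' m : Fin k → ℤ, cotTerm n q k l x y m

/-! ### Surfaces bounding a domain -/

/-- `W` is an open set with (strongly) Lipschitz boundary: near each boundary point, `W` is the
region strictly below the graph, in some unit direction `v`, of a Lipschitz function `g` of the
coordinates orthogonal to `v` (written as a function on `ℝⁿ` that does not depend on the
`v`-coordinate). -/
def IsLipschitzOpen {n : ℕ} (W : Set (E n)) : Prop :=
  IsOpen W ∧ ∀ p ∈ frontier W, ∃ U ∈ 𝓝 p, ∃ (v : E n) (g : E n → ℝ) (K : NNReal),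
    ‖v‖ = 1 ∧ LipschitzWith K g ∧ (∀ (x : E n) (t : ℝ), g (x + t • v) = g x) ∧
    ∀ x ∈ U, (x ∈ W ↔ inner ℝ v x < g x)

/-- `v` is the outer unit normal of `W` at `p`: near `p`, and up to an arbitrarily narrow cone around
the hyperplane `p + v^⊥`, the set `W` is the side of this hyperplane opposite to `v`. -/
def IsOuterUnitNormal {n : ℕ} (W : Set (E n)) (p v : E n) : Prop :=
  ‖v‖ = 1 ∧ ∀ ε > 0, ∀ᶠ x in 𝓝 p,
    (inner ℝ v (x - p) < -(ε * ‖x - p‖) → x ∈ W) ∧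
    (ε * ‖x - p‖ < inner ℝ v (x - p) → x ∉ W)

open Classical in
/-- The outer unit normal `n(p)`, where it exists (on a Lipschitz boundary: almost everywhere). -/
def outerNormal {n : ℕ} (W : Set (E n)) (p : E n) : E n :=
  if h : ∃ v, IsOuterUnitNormal W p v then h.choose else 0

/-- The surface measure of the boundary of `W ⊆ ℝⁿ`: the `(n-1)`-dimensional Hausdorff measure,
normalized so as to agree with Lebesgue measure in dimension `n - 1`. -/
def surfaceMeasure {n : ℕ} (W : Set (E n)) : Measure (E n) :=
  (Measure.euclideanHausdorffMeasure (n - 1)).restrict (frontier W)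

/-- The surface area `ω_n` of the unit sphere of `ℝⁿ`. -/
def sphereArea (n : ℕ) : ℝ := (volume : Measure (E n)).toSphere.real Set.univ

end CliffordCylinder

end

open MeasureTheory CliffordCylinder

noncomputable section

namespace CliffordCylinder

set_option linter.unusedSectionVars false
open Module Set Filter
open scoped NNReal ENNReal

/-! ### The area formula for bi-Lipschitz parametrizations -/

/-! The argument takes place on ℝⁿ, applied to the lift `f`. For a pole `a`, consider the field `u ↦
∑_j (-1)^j G_{j+1}(x - a) u D^j f(x)`. By the Leibniz rule the divergence of its term of index `j`
is `(G_{j+1} D) D^j f + G_{j+1} D^{j+1} f`, where `D` acts on the kernel from the right. Since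
`G_{j+1} D = G_j` for `j ≥ 1` and `G_1 D = 0` away from the pole, the alternating sum telescopes,
and `D^q f = 0` removes its last term: the field is divergence free off `a`
(`sum_fderiv_cauchyField`).

Hence the flux through `∂W` vanishes when `a ∉ closure W` (`integral_cauchyField_of_notMem`). When
`a ∈ W`, the singularity is removed by a radial cutoff at scale `ε`, which leaves the field
unchanged on `∂W`. The only remaining divergence comes from the gradient of the cutoff. After
rescaling, the term of index `j` carries a factor `ε^j`, so in the limit only `j = 0` survives and
gives `ω_n f(a)` (`integral_cauchyField_of_mem`).

The kernel `cot_{p,k,l}(·, y)` is a signed sum of `G_p` with poles `y - m`. Its terms are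
`O(‖m‖^{p-n})` uniformly on `∂W`, which is summable over `ℤᵏ` because `k + p < n`
(`exists_summable_bound_cotTerm`). Sum and surface integral can therefore be exchanged. As the
translates of `W` are disjoint from `W`, the poles with `m ≠ 0` lie outside `closure W`, and only `m
= 0` contributes.

The flux computation needs the divergence theorem on a bounded Lipschitz domain with Hausdorff
surface measure (`setIntegral_fderiv_eq_surface`). A partition of unity reduces it to the region
below a Lipschitz graph. There, the integral of `∂_u φ` is the derivative of the integral of `φ`
over the translated region, computed by Fubini and the fundamental theorem of calculus along
vertical lines. Rademacher's theorem and the area formula for the graph parametrization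
(`area_formula`) convert the result into a surface integral against the normal. -/

theorem measure_le_of_countable_cover {α ι : Type*} [MeasurableSpace α] [Countable ι]
    {μ ν : Measure α} {T : ι → Set α} (hT : ∀ i, MeasurableSet (T i)) (hc : ⋃ i, T i = univ)
    (h : ∀ i S, MeasurableSet S → S ⊆ T i → μ S ≤ ν S) : μ ≤ ν := by
  refine Measure.le_iff.2 fun S hS => ?_
  rcases isEmpty_or_nonempty ι with hι | hι
  · have : S = ∅ := by
      have : (univ : Set α) = ∅ := by rw [← hc]; simp
      exact subset_empty_iff.1 (this ▸ subset_univ S)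
    simp [this]
  obtain ⟨e, he⟩ := exists_surjective_nat ι
  have hm : ∀ n, MeasurableSet (S ∩ disjointed (T ∘ e) n) := fun n =>
    hS.inter (MeasurableSet.disjointed (fun n => hT (e n)) n)
  have hU : S = ⋃ n, S ∩ disjointed (T ∘ e) n := by
    rw [← inter_iUnion, iUnion_disjointed]
    have : ⋃ n, (T ∘ e) n = univ := by rw [← hc]; exact he.iUnion_comp T
    rw [this, inter_univ]
  have hd : Pairwise (Function.onFun Disjoint fun n => S ∩ disjointed (T ∘ e) n) := fun i j hij =>
    (disjoint_disjointed (T ∘ e) hij).mono inter_subset_right inter_subset_right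
  rw [hU, measure_iUnion hd hm, measure_iUnion hd hm]
  exact ENNReal.tsum_le_tsum fun n => h (e n) _ (hm n)
    (inter_subset_right.trans (disjointed_subset (T ∘ e) n))

/-- On `s` the map `f` factors through `g`: composing `f` with a choice of preimages under `g` gives
a `C`-Lipschitz map from `g '' s` onto `f '' s`. Comparing two maps on a common domain lets a
parametrization be measured directly against its linear approximation. -/
theorem hausdorff_image_le_of_dist_le {X Y Z : Type*} [MetricSpace Y]
    [MetricSpace Z] [MeasurableSpace Y] [BorelSpace Y] [MeasurableSpace Z] [BorelSpace Z]
    {f : X → Y} {g : X → Z} {s : Set X} {C : ℝ≥0} (d : ℕ)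
    (h : ∀ x ∈ s, ∀ y ∈ s, dist (f x) (f y) ≤ C * dist (g x) (g y)) :
    Measure.euclideanHausdorffMeasure d (f '' s) ≤
      (C : ℝ≥0∞) ^ d * Measure.euclideanHausdorffMeasure d (g '' s) := by
  classical
  rcases s.eq_empty_or_nonempty with rfl | ⟨x0, hx0⟩
  · simp
  have : ∀ z : Z, ∃ x : X, z ∈ g '' s → x ∈ s ∧ g x = z := fun z => by
    by_cases hz : z ∈ g '' s
    · obtain ⟨x, hx, rfl⟩ := hz
      exact ⟨x, fun _ => ⟨hx, rfl⟩⟩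
    · exact ⟨x0, fun h => absurd h hz⟩
  choose i hi using this
  have hL : LipschitzOnWith C (f ∘ i) (g '' s) := by
    refine LipschitzOnWith.of_dist_le_mul fun a ha b hb => ?_
    have := h _ (hi a ha).1 _ (hi b hb).1
    rwa [(hi a ha).2, (hi b hb).2] at this
  have himg : (f ∘ i) '' (g '' s) = f '' s := by
    ext y
    constructor
    · rintro ⟨z, hz, rfl⟩
      exact ⟨i z, (hi z hz).1, rfl⟩
    · rintro ⟨x, hx, rfl⟩
      refine ⟨g x, ⟨x, hx, rfl⟩, ?_⟩
      have hgx := hi (g x) ⟨x, hx, rfl⟩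
      have := h _ hgx.1 x hx
      rw [hgx.2, dist_self, mul_zero] at this
      exact dist_le_zero.1 this
  have := hL.hausdorffMeasure_image_le (d := d) (by positivity)
  rw [himg, ENNReal.rpow_natCast] at this
  rw [Measure.euclideanHausdorffMeasure_def, Measure.euclideanHausdorffMeasure_def,
    Measure.smul_apply, Measure.smul_apply, ENNReal.smul_def, ENNReal.smul_def, smul_eq_mul,
    smul_eq_mul, mul_left_comm]
  gcongr

section Area

variable {U V : Type*} [NormedAddCommGroup U] [InnerProductSpace ℝ U] [FiniteDimensional ℝ U]
  [MeasurableSpace U] [BorelSpace U]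
  [NormedAddCommGroup V] [InnerProductSpace ℝ V] [FiniteDimensional ℝ V]
  [MeasurableSpace V] [BorelSpace V]

/-- The Jacobian is the factor by which a linear map scales volume, so it suffices to compare the
two images of the unit ball. -/
theorem normDet_le_of_norm_le {A B : U →ₗ[ℝ] V} {C : ℝ≥0} (h : ∀ w, ‖A w‖ ≤ C * ‖B w‖) :
    ENNReal.ofReal A.normDet ≤ (C : ℝ≥0∞) ^ (finrank ℝ U) * ENNReal.ofReal B.normDet := by
  have := hausdorff_image_le_of_dist_le (f := A) (g := B) (s := Metric.ball 0 1) (C := C)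
    (finrank ℝ U) fun x _ y _ => by
      rw [dist_eq_norm, dist_eq_norm, ← map_sub, ← map_sub]; exact h _
  rw [LinearMap.euclideanHausdorffMeasure_image_eq_normDet_mul_volume,
    LinearMap.euclideanHausdorffMeasure_image_eq_normDet_mul_volume, ← mul_assoc] at this
  exact (ENNReal.mul_le_mul_iff_left (Metric.measure_ball_pos volume 0 one_pos).ne'
    measure_ball_lt_top.ne).1 this

variable {γ : U → V} {K : ℝ≥0}

theorem norm_le_norm_of_hasFDerivAt (hγ : ∀ x y, dist x y ≤ dist (γ x) (γ y)) {x : U}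
    {A : U →L[ℝ] V} (hA : HasFDerivAt γ A x) (w : U) : ‖w‖ ≤ ‖A w‖ := by
  have h := (hA.hasLineDerivAt w).tendsto_slope_zero
  refine ge_of_tendsto h.norm ?_
  filter_upwards [self_mem_nhdsWithin] with t ht
  have ht' : t ≠ 0 := ht
  have := hγ (x + t • w) x
  rw [dist_eq_norm, dist_eq_norm, add_sub_cancel_left, norm_smul] at this
  rw [norm_smul, norm_inv]
  rw [inv_mul_eq_div, le_div_iff₀ (norm_pos_iff.2 ht')]
  rw [mul_comm]; exact this

/-- On a set where a bi-Lipschitz map is close to a linear map `A` together with its derivative,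
the area integral and the Hausdorff measure of the image are comparable. -/
theorem area_compare (hγ : ∀ x y, dist x y ≤ dist (γ x) (γ y)) {δ : ℝ≥0}
    {A : U →L[ℝ] V} (hA : ∀ w, ‖w‖ ≤ ‖A w‖) {S : Set U} (hS : MeasurableSet S)
    (happ : ApproximatesLinearOn γ A S δ) (hd : ∀ x ∈ S, DifferentiableAt ℝ γ x)
    (hnear : ∀ x ∈ S, ‖fderiv ℝ γ x - A‖ ≤ δ) :
    ∫⁻ x in S, ENNReal.ofReal (fderiv ℝ γ x).toLinearMap.normDet ≤
        ((1 + δ : ℝ≥0) : ℝ≥0∞) ^ (2 * finrank ℝ U) *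
          Measure.euclideanHausdorffMeasure (finrank ℝ U) (γ '' S) ∧
      Measure.euclideanHausdorffMeasure (finrank ℝ U) (γ '' S) ≤
        ((1 + δ : ℝ≥0) : ℝ≥0∞) ^ (2 * finrank ℝ U) *
          ∫⁻ x in S, ENNReal.ofReal (fderiv ℝ γ x).toLinearMap.normDet := by
  set d := finrank ℝ U
  set c : ℝ≥0∞ := ((1 + δ : ℝ≥0) : ℝ≥0∞) ^ d with hc
  have hctop : c ≠ ∞ := ENNReal.pow_ne_top ENNReal.coe_ne_top
  -- One factor `(1 + δ)^d` pays for replacing the derivative by `A` in the Jacobian, the other for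
  -- replacing `γ` by `A` in the image. Since neither `A`, nor `γ`, nor its derivative shrinks
  -- lengths, the additive errors `δ ‖w‖` become relative errors.
  have h2 : ((1 + δ : ℝ≥0) : ℝ≥0∞) ^ (2 * d) = c * c := by rw [hc, two_mul, pow_add]
  have hlin := A.toLinearMap.euclideanHausdorffMeasure_image_eq_normDet_mul_volume S
  set J := ENNReal.ofReal A.toLinearMap.normDet
  have hJ1 : ∀ x ∈ S, ENNReal.ofReal (fderiv ℝ γ x).toLinearMap.normDet ≤ c * J := by
    intro x hx
    refine normDet_le_of_norm_le fun w => ?_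
    have h1 : ‖(fderiv ℝ γ x - A) w‖ ≤ δ * ‖w‖ :=
      ((fderiv ℝ γ x - A).le_opNorm w).trans (by gcongr; exact hnear x hx)
    rw [sub_apply] at h1
    have h3 := norm_sub_norm_le (fderiv ℝ γ x w) (A w)
    have h4 := hA w
    have h5 : (δ : ℝ) * ‖w‖ ≤ δ * ‖A w‖ := by gcongr
    push_cast
    linarith
  have hJ2 : ∀ x ∈ S, J ≤ c * ENNReal.ofReal (fderiv ℝ γ x).toLinearMap.normDet := by
    intro x hx
    refine normDet_le_of_norm_le fun w => ?_
    have h1 : ‖(fderiv ℝ γ x - A) w‖ ≤ δ * ‖w‖ :=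
      ((fderiv ℝ γ x - A).le_opNorm w).trans (by gcongr; exact hnear x hx)
    rw [sub_apply] at h1
    have h3 := norm_sub_norm_le (A w) (fderiv ℝ γ x w)
    rw [norm_sub_rev] at h3
    have h4 := norm_le_norm_of_hasFDerivAt hγ (hd x hx).hasFDerivAt w
    have h5 : (δ : ℝ) * ‖w‖ ≤ δ * ‖fderiv ℝ γ x w‖ := by gcongr
    push_cast
    linarith
  have hH1 : Measure.euclideanHausdorffMeasure d (γ '' S) ≤
      c * Measure.euclideanHausdorffMeasure d (A '' S) := by
    refine hausdorff_image_le_of_dist_le d fun x hx y hy => ?_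
    have h1 := happ x hx y hy
    have h3 := norm_sub_norm_le (γ x - γ y) (A (x - y))
    have h5 : (δ : ℝ) * ‖x - y‖ ≤ δ * ‖A (x - y)‖ := by gcongr; exact hA _
    rw [dist_eq_norm, dist_eq_norm, ← map_sub]
    push_cast
    linarith
  have hH2 : Measure.euclideanHausdorffMeasure d (A '' S) ≤
      c * Measure.euclideanHausdorffMeasure d (γ '' S) := by
    refine hausdorff_image_le_of_dist_le d fun x hx y hy => ?_
    have h1 := happ x hx y hy
    have h3 := norm_sub_norm_le (A (x - y)) (γ x - γ y)
    rw [norm_sub_rev (A (x - y))] at h3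
    have h4 := hγ x y
    rw [dist_eq_norm, dist_eq_norm] at h4
    have h5 : (δ : ℝ) * ‖x - y‖ ≤ δ * ‖γ x - γ y‖ := by gcongr
    rw [dist_eq_norm, dist_eq_norm, ← map_sub]
    push_cast
    linarith
  rw [h2]
  constructor
  · calc ∫⁻ x in S, ENNReal.ofReal (fderiv ℝ γ x).toLinearMap.normDet
        ≤ ∫⁻ _ in S, c * J := setLIntegral_mono_ae (by fun_prop) (.of_forall hJ1)
      _ = c * (J * volume S) := by rw [setLIntegral_const, mul_assoc]
      _ ≤ c * (c * Measure.euclideanHausdorffMeasure d (γ '' S)) := by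
          exact mul_le_mul_right (hlin.symm.le.trans hH2) c
      _ = _ := by rw [mul_assoc]
  · calc Measure.euclideanHausdorffMeasure d (γ '' S) ≤ c * (J * volume S) := hH1.trans_eq (by
          congr 1)
      _ = c * ∫⁻ _ in S, J := by rw [setLIntegral_const]
      _ ≤ c * ∫⁻ x in S, c * ENNReal.ofReal (fderiv ℝ γ x).toLinearMap.normDet := by
          gcongr 1
          exact setLIntegral_mono' hS hJ2
      _ = _ := by rw [lintegral_const_mul' _ _ hctop, mul_assoc]

theorem hausdorff_image_eq_zero (hL : LipschitzWith K γ) {S : Set U} (hS : volume S = 0) :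
    Measure.euclideanHausdorffMeasure (finrank ℝ U) (γ '' S) = 0 := by
  have h := hausdorff_image_le_of_dist_le (f := γ) (g := id) (s := S) (C := K) (finrank ℝ U)
    fun x _ y _ => hL.dist_le_mul x y
  rw [image_id, InnerProductSpace.euclideanHausdorffMeasure_eq_volume, hS, mul_zero] at h
  exact le_antisymm h zero_le

/-- The area formula for a bi-Lipschitz parametrization that does not decrease distances. -/
theorem area_formula (hL : LipschitzWith K γ) (hγ : ∀ x y, dist x y ≤ dist (γ x) (γ y)) :
    Measure.comap γ (Measure.euclideanHausdorffMeasure (finrank ℝ U)) =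
      (volume : Measure U).withDensity
        fun x => ENNReal.ofReal (fderiv ℝ γ x).toLinearMap.normDet := by
  have hinj : Function.Injective γ := fun x y hxy => by
    have := hγ x y
    rw [hxy, dist_self] at this
    exact dist_le_zero.1 this
  have hemb : MeasurableEmbedding γ := hL.continuous.measurableEmbedding hinj
  set μ₁ := Measure.comap γ (Measure.euclideanHausdorffMeasure (finrank ℝ U)) with hμ₁
  set μ₂ := (volume : Measure U).withDensity
        fun x => ENNReal.ofReal (fderiv ℝ γ x).toLinearMap.normDet with hμ₂
  have e1 : ∀ S, μ₁ S = Measure.euclideanHausdorffMeasure (finrank ℝ U) (γ '' S) :=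
    fun S => hemb.comap_apply _ _
  have e2 : ∀ S, MeasurableSet S →
      μ₂ S = ∫⁻ x in S, ENNReal.ofReal (fderiv ℝ γ x).toLinearMap.normDet :=
    fun S hS => withDensity_apply _ hS
  set D := {x | DifferentiableAt ℝ γ x} with hDdef
  have hD : MeasurableSet D := measurableSet_of_differentiableAt ℝ γ
  have hDc : volume Dᶜ = 0 := hL.ae_differentiableAt
  have key : ∀ δ : ℝ≥0, 0 < δ →
      μ₂ ≤ (((1 + δ : ℝ≥0) : ℝ≥0∞) ^ (2 * finrank ℝ U)) • μ₁ ∧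
      μ₁ ≤ (((1 + δ : ℝ≥0) : ℝ≥0∞) ^ (2 * finrank ℝ U)) • μ₂ := by
    intro δ hδ
    -- On each piece `P k` the derivative stays within `δ / 2` of one map of a countable dense
    -- family. Two values of the derivative on the same piece then differ by less than `δ`; this is
    -- needed because the partition below supplies as `A k n` the derivative at some other point of
    -- `P k`.
    let B : ℕ → (U →L[ℝ] V) := TopologicalSpace.denseSeq _
    let P : ℕ → Set U := fun k => D ∩ {x | ‖fderiv ℝ γ x - B k‖ < δ / 2}
    have hP : ∀ k, MeasurableSet (P k) := fun k =>
      hD.inter (measurableSet_lt ((measurable_fderiv ℝ γ).sub_const _).norm measurable_const)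
    have hPD : D ⊆ ⋃ k, P k := fun x hx => by
      obtain ⟨k, hk⟩ := (TopologicalSpace.denseRange_denseSeq (U →L[ℝ] V)).exists_mem_open
        (Metric.isOpen_ball (x := fderiv ℝ γ x) (ε := (δ / 2 : ℝ)))
        ⟨_, Metric.mem_ball_self (half_pos (NNReal.coe_pos.2 hδ))⟩
      refine mem_iUnion.2 ⟨k, hx, ?_⟩
      rwa [Metric.mem_ball, dist_comm, dist_eq_norm] at hk
    have hpart := fun k => exists_partition_approximatesLinearOn_of_hasFDerivWithinAt γ (P k)
      (fderiv ℝ γ) (fun x hx => hx.1.hasFDerivAt.hasFDerivWithinAt) (fun _ => δ)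
      (fun _ => hδ.ne')
    choose t A htd htm htc htA htn using hpart
    -- The index `none` carries the points of non-differentiability, a null set by Rademacher whose
    -- Lipschitz image is null as well.
    let T : Option (ℕ × ℕ) → Set U := fun o => o.elim Dᶜ fun i => P i.1 ∩ t i.1 i.2
    have hT : ∀ i, MeasurableSet (T i) := by
      rintro (_ | i)
      · exact hD.compl
      · exact (hP i.1).inter (htm i.1 i.2)
    have hTc : ⋃ i, T i = univ := by
      refine eq_univ_of_forall fun x => ?_
      by_cases hx : x ∈ D
      · obtain ⟨k, hk⟩ := mem_iUnion.1 (hPD hx)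
        obtain ⟨n, hn⟩ := mem_iUnion.1 (htc k hk)
        exact mem_iUnion.2 ⟨some (k, n), hk, hn⟩
      · exact mem_iUnion.2 ⟨none, hx⟩
    have main : ∀ i S, MeasurableSet S → S ⊆ T i →
        μ₂ S ≤ ((((1 + δ : ℝ≥0) : ℝ≥0∞) ^ (2 * finrank ℝ U)) • μ₁) S ∧
        μ₁ S ≤ ((((1 + δ : ℝ≥0) : ℝ≥0∞) ^ (2 * finrank ℝ U)) • μ₂) S := by
      rintro (_ | ⟨k, n⟩) S hS hST
      · have h0 : volume S = 0 := measure_mono_null hST hDc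
        have h1 : μ₁ S = 0 := by rw [e1]; exact hausdorff_image_eq_zero hL h0
        have h2 : μ₂ S = 0 := withDensity_absolutelyContinuous _ _ h0
        simp [h1, h2]
      · rw [Measure.smul_apply, Measure.smul_apply, e1, e2 S hS, smul_eq_mul, smul_eq_mul]
        have hSP : S ⊆ P k := hST.trans inter_subset_left
        rcases S.eq_empty_or_nonempty with rfl | ⟨x0, hx0⟩
        · simp
        obtain ⟨y, hy, hAy⟩ := htn k ⟨x0, hSP hx0⟩ n
        refine area_compare hγ (A := A k n) ?_ hS ((htA k n).mono_set hST)
          (fun x hx => (hSP hx).1) fun x hx => ?_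
        · rw [hAy]; exact norm_le_norm_of_hasFDerivAt hγ hy.1.hasFDerivAt
        · rw [hAy]
          have h1 : ‖fderiv ℝ γ x - B k‖ < δ / 2 := (hSP hx).2
          have h2 : ‖fderiv ℝ γ y - B k‖ < δ / 2 := hy.2
          have := norm_sub_le (fderiv ℝ γ x - B k) (fderiv ℝ γ y - B k)
          rw [sub_sub_sub_cancel_right] at this
          linarith
    exact ⟨measure_le_of_countable_cover hT hTc fun i S hS h => (main i S hS h).1,
      measure_le_of_countable_cover hT hTc fun i S hS h => (main i S hS h).2⟩
  -- The two measures agree up to the factor `(1 + δ)^(2d)` for every `δ > 0`; letting `δ → 0` gives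
  -- equality.
  have lim : ∀ a : ℝ≥0∞, Tendsto (fun δ : ℝ≥0 => ((1 + δ : ℝ≥0) : ℝ≥0∞) ^ (2 * finrank ℝ U) * a)
      (𝓝[>] 0) (𝓝 a) := by
    intro a
    have h1 : Tendsto (fun δ : ℝ≥0 => ((1 + δ : ℝ≥0) : ℝ≥0∞) ^ (2 * finrank ℝ U))
        (𝓝[>] 0) (𝓝 1) := by
      have : Continuous fun δ : ℝ≥0 => (((1 + δ) ^ (2 * finrank ℝ U) : ℝ≥0) : ℝ≥0∞) :=
        ENNReal.continuous_coe.comp (by fun_prop)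
      have h := (this.tendsto 0).mono_left (nhdsWithin_le_nhds (s := Ioi 0))
      simpa using h
    have := ENNReal.Tendsto.mul_const (b := a) h1 (Or.inl one_ne_zero)
    simpa using this
  refine le_antisymm ?_ ?_ <;> refine Measure.le_iff.2 fun S hS => ?_
  · exact ge_of_tendsto (lim (μ₂ S)) (by
      filter_upwards [self_mem_nhdsWithin] with δ hδ using (key δ hδ).2 S)
  · exact ge_of_tendsto (lim (μ₁ S)) (by
      filter_upwards [self_mem_nhdsWithin] with δ hδ using (key δ hδ).1 S)

/-- The Jacobian of the graph map `h ↦ L h + ⟨a, h⟩ v`. -/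
theorem normDet_graph (L : U →ₗᵢ[ℝ] V) {v : V} (hv : ‖v‖ = 1) (hLv : ∀ h, inner ℝ v (L h) = 0)
    (b : U →L[ℝ] ℝ) :
    (L.toContinuousLinearMap + b.smulRight v).toLinearMap.normDet = √(1 + ‖b‖ ^ 2) := by
  set f := (L.toContinuousLinearMap + b.smulRight v).toLinearMap
  set a := (InnerProductSpace.toDual ℝ U).symm b with ha
  have hb : ∀ h, b h = inner ℝ a h := fun h => by simp [ha]
  -- The Gram operator is `h ↦ h + b(h) a`, a rank-one perturbation of the identity with determinant
  -- `1 + b(a) = 1 + ‖b‖²`.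
  have hadj : LinearMap.adjoint f ∘ₗ f = LinearMap.transvection b.toLinearMap a := by
    refine LinearMap.ext fun x => ext_inner_left ℝ fun y => ?_
    rw [LinearMap.comp_apply, LinearMap.adjoint_inner_right]
    simp only [f, LinearMap.transvection.apply, ContinuousLinearMap.coe_coe,
      add_apply, ContinuousLinearMap.smulRight_apply,
      LinearIsometry.coe_toContinuousLinearMap, inner_add_left, inner_add_right,
      inner_smul_left, inner_smul_right, LinearIsometry.inner_map_map, hLv,
      real_inner_self_eq_norm_sq, hv]
    rw [← real_inner_comm (L y) v]
    simp only [hLv]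
    simp [hb, real_inner_comm]
  have h1 := f.normDet_sq
  rw [hadj, LinearMap.transvection.det] at h1
  have h2 : b.toLinearMap a = ‖b‖ ^ 2 := by
    rw [ContinuousLinearMap.coe_coe, hb, real_inner_self_eq_norm_sq, ha, LinearIsometryEquiv.norm_map]
  rw [h2] at h1
  rw [← h1]
  simp [Real.sqrt_sq f.normDet_nonneg]

end Area

/-! ### Orthogonal coordinates adapted to a unit direction -/

/-- The linear isometry `ℝᵈ → ℝᵈ⁺¹` that inserts a zero first coordinate. -/
def consZero (d : ℕ) : E d →ₗᵢ[ℝ] E (d + 1) where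
  toFun h := WithLp.toLp 2 (Fin.cons 0 h.ofLp)
  map_add' a b := by
    ext i
    refine Fin.cases ?_ (fun i => ?_) i <;> simp
  map_smul' c a := by
    ext i
    refine Fin.cases ?_ (fun i => ?_) i <;> simp
  norm_map' h := by
    simp [EuclideanSpace.norm_eq, Fin.sum_univ_succ]

/-- Extend `v` to an orthonormal basis with `v` in position 0. The resulting isometry carries the
splitting of `ℝᵈ⁺¹` into the first coordinate and the others to the splitting along `v` and its
orthogonal complement. -/
theorem exists_adapted_coordinates {d : ℕ} {v : E (d + 1)} (hv : ‖v‖ = 1) :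
    ∃ L : E d →ₗᵢ[ℝ] E (d + 1), (∀ h, inner ℝ v (L h) = 0) ∧
      MeasurePreserving (fun p : E d × ℝ => L p.1 + p.2 • v) volume volume := by
  obtain ⟨b, hb⟩ := Orthonormal.exists_orthonormalBasis_extension_of_card_eq (𝕜 := ℝ)
    (E := E (d + 1)) (ι := Fin (d + 1)) (by simp) (v := fun _ => v) (s := {0}) (by
      refine ⟨fun i => hv, fun i j hij => ?_⟩
      exact absurd (Subsingleton.elim i j) hij)
  have hb0 : b 0 = v := hb 0 rfl
  let R : E (d + 1) ≃ₗᵢ[ℝ] E (d + 1) := b.repr.symm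
  have hR0 : R (EuclideanSpace.single 0 1) = v := by
    rw [← hb0]; exact b.repr_symm_single 0
  refine ⟨R.toLinearIsometry.comp (consZero d), fun h => ?_, ?_⟩
  · rw [← hR0, LinearIsometry.coe_comp, Function.comp_apply,
      LinearIsometryEquiv.coe_toLinearIsometry, LinearIsometryEquiv.inner_map_map, EuclideanSpace.inner_single_left]
    simp [consZero]
  · have h1 : MeasurePreserving (Prod.map (WithLp.ofLp : E d → Fin d → ℝ) (id : ℝ → ℝ))
        (volume.prod volume) (volume.prod volume) :=
      (PiLp.volume_preserving_ofLp (Fin d)).prod (MeasurePreserving.id volume)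
    have h2 : MeasurePreserving (Prod.swap : (Fin d → ℝ) × ℝ → ℝ × (Fin d → ℝ))
        (volume.prod volume) (volume.prod volume) := Measure.measurePreserving_swap
    have h3 := (volume_preserving_piFinSuccAbove (fun _ : Fin (d + 1) => ℝ) 0).symm
    have h4 := PiLp.volume_preserving_toLp (Fin (d + 1))
    have h5 := R.measurePreserving
    have h6 := h5.comp (h4.comp (h3.comp (h2.comp h1)))
    have heq : (R ∘ (WithLp.toLp 2 : (Fin (d + 1) → ℝ) → E (d + 1)) ∘
        (MeasurableEquiv.piFinSuccAbove (fun _ : Fin (d + 1) => ℝ) 0).symm ∘ Prod.swap ∘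
        Prod.map (WithLp.ofLp : E d → Fin d → ℝ) (id : ℝ → ℝ)) =
        fun p : E d × ℝ => (R.toLinearIsometry.comp (consZero d)) p.1 + p.2 • v := by
      funext p
      rw [← hR0, ← map_smul]
      refine Eq.trans ?_ (map_add R (consZero d p.1) _)
      simp only [Function.comp_apply]
      congr 1
      ext i
      refine Fin.cases ?_ (fun i => ?_) i
      · simp [consZero, MeasurableEquiv.piFinSuccAbove]
      · simp [consZero, MeasurableEquiv.piFinSuccAbove]
    rw [← heq]
    exact h6

/-- This turns the volume side of the divergence theorem into the derivative of a one-parameter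
family, with no regularity asked of `Ω`. For `|s| < 1` all translates of the support lie in the ball
of radius `R + ‖u‖`, which yields the dominating function. -/
theorem hasDerivAt_setIntegral_shift {X F : Type*} [NormedAddCommGroup X] [NormedSpace ℝ X]
    [FiniteDimensional ℝ X] [MeasurableSpace X] [BorelSpace X] (μ : Measure X)
    [IsLocallyFiniteMeasure μ] [NormedAddCommGroup F] [NormedSpace ℝ F]
    {φ : X → F} (hφ : ContDiff ℝ 1 φ) (hc : HasCompactSupport φ) (Ω : Set X) (u : X) :
    HasDerivAt (fun s : ℝ => ∫ x in Ω, φ (x + s • u) ∂μ) (∫ x in Ω, fderiv ℝ φ x u ∂μ) 0 := by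
  have hcont : Continuous fun x => fderiv ℝ φ x u :=
    (hφ.continuous_fderiv one_ne_zero).clm_apply continuous_const
  have hcs : HasCompactSupport fun x => fderiv ℝ φ x u := hc.fderiv_apply (𝕜 := ℝ) u
  obtain ⟨M, hM⟩ := hcs.exists_bound_of_continuous hcont
  obtain ⟨R, hR⟩ := hcs.isCompact.isBounded.subset_closedBall (0 : X)
  have hM0 : 0 ≤ M := (norm_nonneg _).trans (hM 0)
  have := (hasDerivAt_integral_of_dominated_loc_of_deriv_le (𝕜 := ℝ) (μ := μ.restrict Ω)
    (F := fun s x => φ (x + s • u)) (F' := fun s x => fderiv ℝ φ (x + s • u) u) (x₀ := (0 : ℝ))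
    (s := Metric.ball 0 1) (bound := (Metric.closedBall (0 : X) (R + ‖u‖)).indicator fun _ => M)
    (Metric.ball_mem_nhds _ one_pos) ?_ ?_ ?_ ?_ ?_ ?_).2
  · simpa using this
  · exact .of_forall fun s => (hφ.continuous.comp (by fun_prop)).aestronglyMeasurable
  · simp only [zero_smul, add_zero]
    exact (hφ.continuous.integrable_of_hasCompactSupport hc).integrableOn
  · simp only [zero_smul, add_zero]
    exact hcont.aestronglyMeasurable
  · refine .of_forall fun x s hs => ?_
    by_cases hx : x ∈ Metric.closedBall (0 : X) (R + ‖u‖)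
    · rw [indicator_of_mem hx]; exact hM _
    · rw [indicator_of_notMem hx]
      refine (norm_eq_zero.2 ?_).le
      by_contra h0
      have h1 := hR (subset_tsupport _ h0)
      rw [mem_closedBall_zero_iff] at h1 hx
      rw [Metric.mem_ball, dist_zero_right] at hs
      have h2 := norm_sub_le (x + s • u) (s • u)
      rw [add_sub_cancel_right, norm_smul] at h2
      have h3 : ‖s‖ * ‖u‖ ≤ 1 * ‖u‖ := by gcongr
      apply hx
      linarith
  · refine Integrable.integrableOn ?_
    exact (integrable_indicator_iff measurableSet_closedBall).2
      (integrableOn_const (isCompact_closedBall _ _).measure_lt_top.ne)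
  · refine .of_forall fun x s _ => ?_
    have h1 : HasDerivAt (fun s : ℝ => x + s • u) u s := by
      simpa using ((hasDerivAt_id s).smul_const u).const_add x
    exact ((hφ.differentiable one_ne_zero _).hasFDerivAt).comp_hasDerivAt s h1

/-! ### The region below a Lipschitz graph -/

/-- The parametrization `h ↦ L h + g(L h) v` of the graph of `g`. -/
def graphParam {d : ℕ} (L : E d →ₗᵢ[ℝ] E (d + 1)) (v : E (d + 1)) (g : E (d + 1) → ℝ) (h : E d) :
    E (d + 1) := L h + g (L h) • v

/-- The strict subgraph of `g` in the direction `v`. -/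
def subgraph {n : ℕ} (v : E n) (g : E n → ℝ) : Set (E n) := {x | inner ℝ v x < g x}

section Graph

variable {d : ℕ} {v : E (d + 1)} {L : E d →ₗᵢ[ℝ] E (d + 1)} {g : E (d + 1) → ℝ} {K : ℝ≥0}
  {F : Type*} [NormedAddCommGroup F] [NormedSpace ℝ F] {φ : E (d + 1) → F}

theorem inner_coordinates (hv : ‖v‖ = 1) (hLv : ∀ h, inner ℝ v (L h) = 0) (h : E d) (t : ℝ) :
    inner ℝ v (L h + t • v) = t := by
  rw [inner_add_right, hLv, inner_smul_right, real_inner_self_eq_norm_sq, hv]; simp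

theorem norm_sq_coordinates (hv : ‖v‖ = 1) (hLv : ∀ h, inner ℝ v (L h) = 0) (h : E d) (t : ℝ) :
    ‖L h + t • v‖ ^ 2 = ‖h‖ ^ 2 + t ^ 2 := by
  rw [norm_add_sq_real, inner_smul_right, real_inner_comm, hLv, LinearIsometry.norm_map, norm_smul,
    hv]
  simp

theorem norm_le_norm_coordinates (hv : ‖v‖ = 1) (hLv : ∀ h, inner ℝ v (L h) = 0) (h : E d)
    (t : ℝ) : ‖h‖ ≤ ‖L h + t • v‖ := by
  refine le_of_sq_le_sq ?_ (norm_nonneg _)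
  rw [norm_sq_coordinates hv hLv]
  nlinarith [sq_nonneg t]

theorem measurableEmbedding_coordinates (hv : ‖v‖ = 1) (hLv : ∀ h, inner ℝ v (L h) = 0) :
    MeasurableEmbedding (fun p : E d × ℝ => L p.1 + p.2 • v) := by
  refine Continuous.measurableEmbedding (by fun_prop) fun p q hpq => ?_
  have h0 : L (p.1 - q.1) + (p.2 - q.2) • v = 0 := by
    rw [map_sub, sub_smul]
    rw [sub_add_sub_comm]
    exact sub_eq_zero.2 hpq
  have h1 := norm_sq_coordinates hv hLv (p.1 - q.1) (p.2 - q.2)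
  rw [h0, norm_zero] at h1
  have h2 : ‖p.1 - q.1‖ ^ 2 = 0 := by nlinarith [sq_nonneg (p.2 - q.2), sq_nonneg ‖p.1 - q.1‖]
  have h3 : (p.2 - q.2) ^ 2 = 0 := by nlinarith [sq_nonneg (p.2 - q.2), sq_nonneg ‖p.1 - q.1‖]
  exact Prod.ext (sub_eq_zero.1 (norm_eq_zero.1 (pow_eq_zero_iff two_ne_zero |>.1 h2)))
    (sub_eq_zero.1 (pow_eq_zero_iff two_ne_zero |>.1 h3))

/-- The height over `h` of the graph of `g` translated by `-s u`. -/
def shiftedHeight (L : E d →ₗᵢ[ℝ] E (d + 1)) (v : E (d + 1)) (g : E (d + 1) → ℝ) (u : E (d + 1))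
    (s : ℝ) (h : E d) : ℝ := g (L h - s • u) + s * inner ℝ v u

/-- Translation invariance moves the shift from the integrand to the region. The shifted region is
again a subgraph, and Fubini in the adapted coordinates slices it into half-lines; their endpoints
are negligible. -/
theorem integrable_and_integral_subgraph_shift (hv : ‖v‖ = 1) (hLv : ∀ h, inner ℝ v (L h) = 0)
    (hmp : MeasurePreserving (fun p : E d × ℝ => L p.1 + p.2 • v) volume volume)
    (hg : LipschitzWith K g) (hgv : ∀ (x : E (d + 1)) (t : ℝ), g (x + t • v) = g x)
    (hφ : Continuous φ) (hc : HasCompactSupport φ) (u : E (d + 1)) (s : ℝ) :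
    Integrable (fun h : E d => ∫ t in Iic (shiftedHeight L v g u s h), φ (L h + t • v)) ∧
    ∫ x in subgraph v g, φ (x + s • u) =
      ∫ h : E d, ∫ t in Iic (shiftedHeight L v g u s h), φ (L h + t • v) := by
  have hΩm : MeasurableSet {x | x - s • u ∈ subgraph v g} :=
    (isOpen_lt (by fun_prop) (hg.continuous.comp (by fun_prop))).measurableSet
  have hΩm0 : MeasurableSet (subgraph v g) :=
    (isOpen_lt (by fun_prop) hg.continuous).measurableSet
  have hi : Integrable ({x | x - s • u ∈ subgraph v g}.indicator φ) :=
    (hφ.integrable_of_hasCompactSupport hc).indicator hΩm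
  have hemb := measurableEmbedding_coordinates hv hLv
  have hi2 := (hmp.integrable_comp_emb hemb).2 hi
  have hpt : ∀ h : E d, ∀ t : ℝ, {x | x - s • u ∈ subgraph v g}.indicator φ (L h + t • v) =
      (Iio (shiftedHeight L v g u s h)).indicator (fun t => φ (L h + t • v)) t := by
    intro h t
    have : L h + t • v ∈ {x | x - s • u ∈ subgraph v g} ↔
        t ∈ Iio (shiftedHeight L v g u s h) := by
      simp only [subgraph, mem_ofPred_eq, mem_Iio, shiftedHeight]
      rw [inner_sub_right, inner_coordinates hv hLv, inner_smul_right, add_sub_right_comm, hgv,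
        sub_lt_iff_lt_add]
    by_cases ht : t ∈ Iio (shiftedHeight L v g u s h)
    · rw [indicator_of_mem ht, indicator_of_mem (this.2 ht)]
    · rw [indicator_of_notMem ht, indicator_of_notMem (fun h => ht (this.1 h))]
  have hin : ∀ h : E d, ∫ t : ℝ, {x | x - s • u ∈ subgraph v g}.indicator φ (L h + t • v) =
      ∫ t : ℝ in Iic (shiftedHeight L v g u s h), φ (L h + t • v) := by
    intro h
    rw [integral_congr_ae (.of_forall (hpt h)), integral_indicator measurableSet_Iio, integral_Iic_eq_integral_Iio]
  constructor
  · have := Integrable.integral_prod_left hi2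
    simp only [Function.comp_def, hin] at this
    exact this
  · rw [← integral_indicator hΩm0]
    have : (fun x => (subgraph v g).indicator (fun x => φ (x + s • u)) x) =
        fun x => ({x | x - s • u ∈ subgraph v g}.indicator φ) (x + s • u) := by
      funext x
      by_cases hx : x ∈ subgraph v g
      · rw [indicator_of_mem hx, indicator_of_mem]
        simpa using hx
      · rw [indicator_of_notMem hx, indicator_of_notMem]
        simpa using hx
    rw [this, integral_add_right_eq_self ({x | x - s • u ∈ subgraph v g}.indicator φ),
      ← hmp.integral_comp hemb, Measure.volume_eq_prod]
    refine (integral_prod _ hi2).trans ?_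
    simp only [Function.comp_def, hin]

/-- As `g` is constant along `v`, the base point `L h` may be replaced by the graph point above it;
the rest is the chain rule. -/
theorem hasDerivAt_shiftedHeight (hgv : ∀ (x : E (d + 1)) (t : ℝ), g (x + t • v) = g x)
    {h : E d} (hd : DifferentiableAt ℝ g (graphParam L v g h)) (u : E (d + 1)) :
    HasDerivAt (fun s => shiftedHeight L v g u s h)
      (inner ℝ v u - fderiv ℝ g (graphParam L v g h) u) 0 := by
  have h1 : HasDerivAt (fun s : ℝ => graphParam L v g h - s • u) (-u) 0 := by
    simpa using ((hasDerivAt_id (0 : ℝ)).smul_const u).const_sub (graphParam L v g h)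
  have h2 : HasDerivAt (fun s : ℝ => g (graphParam L v g h - s • u))
      (fderiv ℝ g (graphParam L v g h) (-u)) 0 := by
    refine HasFDerivAt.comp_hasDerivAt (x := (0 : ℝ)) (l := g) ?_ h1
    simpa using hd.hasFDerivAt
  have h3 : HasDerivAt (fun s : ℝ => s * inner ℝ v u) (inner ℝ v u) 0 := by
    simpa using (hasDerivAt_id (0 : ℝ)).mul_const (inner ℝ v u)
  convert! h2.add h3 using 1
  · funext s
    simp only [shiftedHeight, graphParam, Pi.add_apply]
    rw [add_sub_right_comm, hgv]
  · rw [map_neg]; ring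

/-- The graph is null in the ambient space, so Rademacher's theorem says nothing about it directly.
By Fubini almost every line parallel to `v` contains a point of differentiability, and invariance
along `v` propagates differentiability to the whole line, in particular to the graph. -/
theorem ae_differentiableAt_graphParam
    (hmp : MeasurePreserving (fun p : E d × ℝ => L p.1 + p.2 • v) volume volume)
    (hg : LipschitzWith K g) (hgv : ∀ (x : E (d + 1)) (t : ℝ), g (x + t • v) = g x) :
    ∀ᵐ h : E d, DifferentiableAt ℝ g (graphParam L v g h) := by
  have h1 : ∀ᵐ x : E (d + 1), DifferentiableAt ℝ g x := hg.ae_differentiableAt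
  have h2 : ∀ᵐ p : E d × ℝ, DifferentiableAt ℝ g (L p.1 + p.2 • v) :=
    hmp.quasiMeasurePreserving.ae h1
  rw [Measure.volume_eq_prod] at h2
  have hshift : ∀ (x : E (d + 1)) (t : ℝ), DifferentiableAt ℝ g x →
      DifferentiableAt ℝ g (x + t • v) := by
    intro x t hx
    have : g = fun y => g (y - t • v) := by
      funext y
      have := hgv (y - t • v) t
      rwa [sub_add_cancel] at this
    rw [this]
    have hx' : DifferentiableAt ℝ g ((x + t • v) - t • v) := by rwa [add_sub_cancel_right]
    exact DifferentiableAt.comp (x + t • v) hx' (by fun_prop)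
  filter_upwards [Measure.ae_ae_of_ae_prod h2] with h hh
  obtain ⟨t, ht⟩ := hh.exists
  have := hshift _ (g (L h) - t) ht
  rwa [add_assoc, ← add_smul, add_sub_cancel] at this

theorem continuous_graphParam (hg : LipschitzWith K g) : Continuous (graphParam L v g) :=
  L.continuous.add ((hg.continuous.comp L.continuous).smul continuous_const)

/-- The divergence theorem for the region below a Lipschitz graph, with the boundary integral in
the coordinates of the graph. -/
theorem integrable_and_integral_fderiv_subgraph (hv : ‖v‖ = 1) (hLv : ∀ h, inner ℝ v (L h) = 0)
    (hmp : MeasurePreserving (fun p : E d × ℝ => L p.1 + p.2 • v) volume volume)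
    (hg : LipschitzWith K g) (hgv : ∀ (x : E (d + 1)) (t : ℝ), g (x + t • v) = g x)
    [CompleteSpace F] (hφ : ContDiff ℝ 1 φ) (hc : HasCompactSupport φ) (u : E (d + 1)) :
    ∫ x in subgraph v g, fderiv ℝ φ x u =
      ∫ h : E d, (inner ℝ v u - fderiv ℝ g (graphParam L v g h) u) • φ (graphParam L v g h) := by
  have hLHS := hasDerivAt_setIntegral_shift volume hφ hc (subgraph v g) u
  have hI := integrable_and_integral_subgraph_shift hv hLv hmp hg hgv hφ.continuous hc u
  set H := shiftedHeight L v g u with hH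
  -- Subtracting the slice at `s = 0` replaces the half-line by the interval between two heights,
  -- whose length is at most a constant times `|s|`.
  let I : ℝ → E d → F := fun s h => ∫ t in (H 0 h)..(H s h), φ (L h + t • v)
  have hcl : ∀ h : E d, Topology.IsClosedEmbedding fun t : ℝ => L h + t • v := by
    intro h
    refine Isometry.isClosedEmbedding (Isometry.of_dist_eq fun a b => ?_)
    rw [dist_eq_norm, dist_eq_norm, add_sub_add_left_eq_sub, ← sub_smul, norm_smul, hv, mul_one]
  have hcont : ∀ h : E d, Continuous fun t : ℝ => φ (L h + t • v) := fun h =>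
    hφ.continuous.comp (by fun_prop)
  have hint : ∀ h : E d, Integrable fun t : ℝ => φ (L h + t • v) := by
    intro h
    refine (hcont h).integrable_of_hasCompactSupport ?_
    exact hc.comp_isClosedEmbedding (hcl h)
  have hIeq : ∀ s h, I s h = (∫ t in Iic (H s h), φ (L h + t • v)) -
      ∫ t in Iic (H 0 h), φ (L h + t • v) := fun s h =>
    (intervalIntegral.integral_Iic_sub_Iic (hint h).integrableOn (hint h).integrableOn).symm
  have hIint : ∀ s, Integrable (I s) := fun s => by
    have := (hI s).1.sub (hI 0).1
    refine this.congr (.of_forall fun h => ?_)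
    rw [hIeq]; rfl
  obtain ⟨M, hM⟩ := hc.exists_bound_of_continuous hφ.continuous
  have hM0 : 0 ≤ M := (norm_nonneg _).trans (hM 0)
  obtain ⟨R, hR⟩ := hc.isCompact.isBounded.subset_closedBall (0 : E (d + 1))
  have hHlip : ∀ s s' h, |H s h - H s' h| ≤ (K + 1) * ‖u‖ * |s - s'| := by
    intro s s' h
    have h1 := hg.dist_le_mul (L h - s • u) (L h - s' • u)
    rw [dist_eq_norm, dist_eq_norm, sub_sub_sub_cancel_left, ← sub_smul, norm_smul,
      Real.norm_eq_abs, Real.norm_eq_abs] at h1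
    have h2 : |inner ℝ v u| ≤ ‖u‖ := by
      have := abs_real_inner_le_norm v u
      rwa [hv, one_mul] at this
    have h3 : H s h - H s' h = (g (L h - s • u) - g (L h - s' • u)) + (s - s') * inner ℝ v u := by
      simp only [hH, shiftedHeight]; ring
    rw [h3]
    refine (abs_add_le _ _).trans ?_
    rw [abs_mul, abs_sub_comm s' s] at *
    have h4 : |s - s'| * |inner ℝ v u| ≤ |s - s'| * ‖u‖ := by gcongr
    linarith
  have hIlip : ∀ s s' h, ‖I s h - I s' h‖ ≤ M * ((K + 1) * ‖u‖) * |s - s'| := by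
    intro s s' h
    have : I s h - I s' h = ∫ t in (H s' h)..(H s h), φ (L h + t • v) :=
      intervalIntegral.integral_interval_sub_left (hint h).intervalIntegrable
        (hint h).intervalIntegrable
    rw [this, mul_assoc]
    refine (intervalIntegral.norm_integral_le_of_norm_le_const fun t _ => hM _).trans ?_
    gcongr
    exact hHlip s s' h
  have hIzero : ∀ s h, h ∉ Metric.closedBall (0 : E d) R → I s h = 0 := by
    intro s h hh
    have : ∀ t : ℝ, φ (L h + t • v) = 0 := by
      intro t
      by_contra h0
      have h1 := hR (subset_tsupport _ h0)
      rw [mem_closedBall_zero_iff] at h1 hh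
      exact hh ((norm_le_norm_coordinates hv hLv h t).trans h1)
    simp only [I, this, intervalIntegral.integral_zero]
  -- This form of differentiation under the integral asks for a Lipschitz bound in `s` and
  -- differentiability at `s = 0` for almost every `h` only, which is exactly what Rademacher
  -- provides. The two computations of the same derivative are then compared.
  have hRHS := (hasDerivAt_integral_of_dominated_loc_of_lip (𝕜 := ℝ) (μ := (volume : Measure (E d)))
    (F := I) (x₀ := (0 : ℝ)) (s := univ)
    (F' := fun h => (inner ℝ v u - fderiv ℝ g (graphParam L v g h) u) • φ (graphParam L v g h))
    (bound := (Metric.closedBall (0 : E d) R).indicator fun _ => M * ((K + 1) * ‖u‖))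
    univ_mem ?_ (hIint 0) ?_ ?_ ?_ ?_).2
  · have hfun : (fun s : ℝ => ∫ x in subgraph v g, φ (x + s • u)) =
        fun s => (∫ h, I s h) + ∫ h, ∫ t in Iic (H 0 h), φ (L h + t • v) := by
      funext s
      rw [(hI s).2, ← integral_add (hIint s) (hI 0).1]
      refine integral_congr_ae (.of_forall fun h => ?_)
      simp only [hIeq, sub_add_cancel]
    rw [hfun] at hLHS
    exact hLHS.unique (hRHS.add_const _)
  · exact .of_forall fun s => (hIint s).1
  · have hm : Measurable fun h : E d => inner ℝ v u - fderiv ℝ g (graphParam L v g h) u :=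
      measurable_const.sub
        ((measurable_fderiv_apply_const ℝ g u).comp (continuous_graphParam hg).measurable)
    exact (hm.stronglyMeasurable.smul
      (hφ.continuous.comp (continuous_graphParam hg)).stronglyMeasurable).aestronglyMeasurable
  · refine .of_forall fun h => LipschitzOnWith.of_dist_le_mul fun s _ s' _ => ?_
    rw [dist_eq_norm, Real.dist_eq, Real.coe_nnabs]
    by_cases hh : h ∈ Metric.closedBall (0 : E d) R
    · rw [indicator_of_mem hh, abs_of_nonneg (by positivity)]
      exact hIlip s s' h
    · rw [hIzero s h hh, hIzero s' h hh, sub_self, norm_zero]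
      positivity
  · exact (integrable_indicator_iff measurableSet_closedBall).2
      (integrableOn_const (isCompact_closedBall _ _).measure_lt_top.ne)
  · filter_upwards [ae_differentiableAt_graphParam hmp hg hgv] with h hh
    have h1 := hasDerivAt_shiftedHeight hgv hh u
    have h2 : HasDerivAt (fun b => ∫ t in (H 0 h)..b, φ (L h + t • v)) (φ (L h + H 0 h • v))
        (H 0 h) :=
      intervalIntegral.integral_hasDerivAt_right (hint h).intervalIntegrable
        ((hcont h).stronglyMeasurableAtFilter _ _) (hcont h).continuousAt
    have h3 := h2.scomp (0 : ℝ) h1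
    have h4 : L h + H 0 h • v = graphParam L v g h := by
      simp [hH, shiftedHeight, graphParam]
    rw [h4] at h3
    exact h3

end Graph

/-! ### Outer normals -/

/-- If the normals differed, moving from `p` in the direction `w - v` would go strictly inward for
`v` and strictly outward for `w`, placing the same points inside and outside `W`. -/
theorem IsOuterUnitNormal.unique {n : ℕ} {W : Set (E n)} {p v w : E n}
    (hv : IsOuterUnitNormal W p v) (hw : IsOuterUnitNormal W p w) : v = w := by
  by_contra hne
  have hlt : inner ℝ v w < 1 := inner_lt_one_iff_real_of_norm_eq_one hv.1 hw.1 |>.2 hne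
  set z := w - v with hz
  have hz0 : 0 < ‖z‖ := norm_pos_iff.2 (sub_ne_zero.2 (Ne.symm hne))
  have h1 : inner ℝ v z = inner ℝ v w - 1 := by
    rw [hz, inner_sub_right, real_inner_self_eq_norm_sq, hv.1]; ring
  have h2 : inner ℝ w z = 1 - inner ℝ v w := by
    rw [hz, inner_sub_right, real_inner_self_eq_norm_sq, hw.1, real_inner_comm]; ring
  -- Along `z` the slopes are `±(1 - ⟨v, w⟩)`; this `ε` gives a cone with half that slope.
  set ε := (1 - inner ℝ v w) / (2 * ‖z‖) with hε
  have hε0 : 0 < ε := div_pos (by linarith) (by positivity)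
  have hεz : ε * ‖z‖ = (1 - inner ℝ v w) / 2 := by rw [hε]; field_simp
  have hlim : Tendsto (fun t : ℝ => p + t • z) (𝓝[>] 0) (𝓝 p) := by
    have : Continuous fun t : ℝ => p + t • z := by fun_prop
    have := this.tendsto 0
    rw [zero_smul, add_zero] at this
    exact this.mono_left nhdsWithin_le_nhds
  have hev := hlim.eventually ((hv.2 ε hε0).and (hw.2 ε hε0))
  obtain ⟨t, ⟨ha, hb⟩, ht⟩ := (hev.and self_mem_nhdsWithin).exists
  have ht0 : 0 < t := ht
  rw [add_sub_cancel_left, inner_smul_right, norm_smul, Real.norm_of_nonneg ht0.le] at ha hb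
  refine hb.2 ?_ (ha.1 ?_)
  · rw [h2]
    have : ε * (t * ‖z‖) = t * (ε * ‖z‖) := by ring
    rw [this, hεz]
    nlinarith
  · rw [h1]
    have : ε * (t * ‖z‖) = t * (ε * ‖z‖) := by ring
    rw [this, hεz]
    nlinarith

theorem outerNormal_eq {n : ℕ} {W : Set (E n)} {p v : E n} (h : IsOuterUnitNormal W p v) :
    outerNormal W p = v := by
  have hex : ∃ v, IsOuterUnitNormal W p v := ⟨v, h⟩
  rw [outerNormal, dif_pos hex]
  exact hex.choose_spec.unique h

theorem norm_outerNormal_le {n : ℕ} (W : Set (E n)) (p : E n) : ‖outerNormal W p‖ ≤ 1 := by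
  rw [outerNormal]
  split_ifs with h
  · exact h.choose_spec.1.le
  · simp

/-- The unit normal `(v - ∇g) / ‖v - ∇g‖` of the graph of `g`. -/
def graphNormal {n : ℕ} (v : E n) (g : E n → ℝ) (x : E n) : E n :=
  ‖v - gradient g x‖⁻¹ • (v - gradient g x)

section Normal

variable {n : ℕ} {v : E n} {g : E n → ℝ}

theorem measurable_gradient (g : E n → ℝ) : Measurable (gradient g) :=
  (InnerProductSpace.toDual ℝ (E n)).symm.continuous.measurable.comp (measurable_fderiv ℝ g)

theorem measurable_graphNormal (v : E n) (g : E n → ℝ) : Measurable (graphNormal v g) := by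
  have := (measurable_gradient g).const_sub v
  exact this.norm.inv.smul this

theorem inner_gradient_direction (hgv : ∀ (x : E n) (t : ℝ), g (x + t • v) = g x) (x : E n) :
    inner ℝ v (gradient g x) = 0 := by
  by_cases hd : DifferentiableAt ℝ g x
  · rw [real_inner_comm, inner_gradient_left]
    have h1 := (hd.hasFDerivAt.hasLineDerivAt v).lineDeriv
    have h2 : lineDeriv ℝ g x v = 0 := by
      simp only [lineDeriv, hgv]
      exact deriv_const _ _
    rw [← h1, h2]
  · rw [gradient, fderiv_zero_of_not_differentiableAt hd]; simp

theorem norm_sub_gradient_sq (hv : ‖v‖ = 1)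
    (hgv : ∀ (x : E n) (t : ℝ), g (x + t • v) = g x) (x : E n) :
    ‖v - gradient g x‖ ^ 2 = 1 + ‖gradient g x‖ ^ 2 := by
  rw [norm_sub_sq_real, inner_gradient_direction hgv, hv]; ring

theorem norm_sub_gradient_pos (hv : ‖v‖ = 1)
    (hgv : ∀ (x : E n) (t : ℝ), g (x + t • v) = g x) (x : E n) : 0 < ‖v - gradient g x‖ := by
  have h := norm_sub_gradient_sq hv hgv x
  refine lt_of_le_of_ne (norm_nonneg _) fun h0 => ?_
  rw [← h0] at h
  nlinarith [sq_nonneg ‖gradient g x‖]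

/-- Near `p` the defining function satisfies `⟨v, x⟩ - g x = c ⟨ν, x - p⟩ + o(‖x - p‖)`, where `ν`
is the graph normal and `c = ‖v - ∇g‖`. Outside a thin cone around the tangent hyperplane the linear
term decides its sign. -/
theorem isOuterUnitNormal_graphNormal (hv : ‖v‖ = 1)
    (hgv : ∀ (x : E n) (t : ℝ), g (x + t • v) = g x) {W U : Set (E n)} {p : E n} (hU : U ∈ 𝓝 p)
    (hW : ∀ x ∈ U, (x ∈ W ↔ x ∈ subgraph v g)) (hp : inner ℝ v p = g p)
    (hd : DifferentiableAt ℝ g p) : IsOuterUnitNormal W p (graphNormal v g p) := by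
  have hc := norm_sub_gradient_pos hv hgv p
  set c := ‖v - gradient g p‖ with hcdef
  refine ⟨?_, fun ε hε => ?_⟩
  · rw [graphNormal, norm_smul, norm_inv, norm_norm]
    exact inv_mul_cancel₀ hc.ne'
  · have hlo := hd.hasFDerivAt.isLittleO.def (mul_pos hε hc)
    filter_upwards [hlo, hU] with x hx hxU
    rw [← inner_gradient_left, Real.norm_eq_abs, abs_le] at hx
    have hin : inner ℝ (graphNormal v g p) (x - p) =
        c⁻¹ * (inner ℝ v x - g p - inner ℝ (gradient g p) (x - p)) := by
      rw [graphNormal, inner_smul_left, inner_sub_left, inner_sub_right, hp]; simp [hcdef]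
    have hin' : inner ℝ v x - g p - inner ℝ (gradient g p) (x - p) =
        c * inner ℝ (graphNormal v g p) (x - p) := by
      rw [hin]; field_simp
    rw [hW x hxU, subgraph, mem_ofPred_eq]
    constructor
    · intro h
      have := mul_lt_mul_of_pos_left h hc
      linarith
    · intro h
      have := mul_lt_mul_of_pos_left h hc
      linarith

end Normal

/-! ### Surface integrals over Lipschitz graphs -/

section Graph

variable {d : ℕ} {v : E (d + 1)} {L : E d →ₗᵢ[ℝ] E (d + 1)} {g : E (d + 1) → ℝ} {K : ℝ≥0}
  {F : Type*} [NormedAddCommGroup F] [NormedSpace ℝ F]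

/-- The coordinate map is linear and injective between spaces of equal dimension. -/
theorem surjective_coordinates (hv : ‖v‖ = 1) (hLv : ∀ h, inner ℝ v (L h) = 0) (x : E (d + 1)) :
    ∃ h, L h + (inner ℝ v x) • v = x := by
  let T : E d × ℝ →ₗ[ℝ] E (d + 1) :=
    L.toLinearMap.coprod (LinearMap.toSpanSingleton ℝ (E (d + 1)) v)
  have hT : ∀ p : E d × ℝ, T p = L p.1 + p.2 • v := fun p => by simp [T]
  have hinj : Function.Injective T := by
    have := (measurableEmbedding_coordinates hv hLv).injective
    intro p q hpq
    rw [hT, hT] at hpq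
    exact this hpq
  have hsurj := (LinearMap.injective_iff_surjective_of_finrank_eq_finrank (f := T)
    (by simp)).1 hinj
  obtain ⟨p, hp⟩ := hsurj x
  rw [hT] at hp
  refine ⟨p.1, ?_⟩
  rw [← hp, inner_coordinates hv hLv]

theorem range_graphParam (hv : ‖v‖ = 1) (hLv : ∀ h, inner ℝ v (L h) = 0)
    (hgv : ∀ (x : E (d + 1)) (t : ℝ), g (x + t • v) = g x) :
    range (graphParam L v g) = {x | inner ℝ v x = g x} := by
  ext x
  constructor
  · rintro ⟨h, rfl⟩
    simp only [graphParam, mem_ofPred_eq]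
    rw [inner_coordinates hv hLv, hgv]
  · intro hx
    rw [mem_ofPred_eq] at hx
    obtain ⟨h, hh⟩ := surjective_coordinates hv hLv x
    refine ⟨h, ?_⟩
    have h1 : g (L h) = g x := by
      conv_rhs => rw [← hh]
      exact (hgv _ _).symm
    rw [graphParam, h1, ← hx, hh]

/-- The parameter is recovered by projecting orthogonally to `v`, which does not increase distances.
This is the lower bound that `area_formula` requires. -/
theorem dist_le_dist_graphParam (hv : ‖v‖ = 1) (hLv : ∀ h, inner ℝ v (L h) = 0) (x y : E d) :
    dist x y ≤ dist (graphParam L v g x) (graphParam L v g y) := by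
  rw [dist_eq_norm, dist_eq_norm, graphParam, graphParam, add_sub_add_comm, ← map_sub, ← sub_smul]
  exact norm_le_norm_coordinates hv hLv _ _

theorem lipschitzWith_graphParam (hv : ‖v‖ = 1) (hg : LipschitzWith K g) :
    LipschitzWith (1 + K) (graphParam L v g) := by
  refine LipschitzWith.of_dist_le_mul fun x y => ?_
  rw [dist_eq_norm, graphParam, graphParam, add_sub_add_comm, ← map_sub, ← sub_smul]
  refine (norm_add_le _ _).trans ?_
  rw [L.norm_map, norm_smul, hv, mul_one]
  have h1 := hg.dist_le_mul (L x) (L y)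
  rw [L.isometry.dist_eq, dist_eq_norm, dist_eq_norm] at h1
  rw [dist_eq_norm]
  push_cast
  linarith

theorem measurableEmbedding_graphParam (hv : ‖v‖ = 1) (hLv : ∀ h, inner ℝ v (L h) = 0)
    (hg : LipschitzWith K g) : MeasurableEmbedding (graphParam L v g) := by
  refine (continuous_graphParam hg).measurableEmbedding fun x y hxy => ?_
  have := dist_le_dist_graphParam (g := g) hv hLv x y
  rw [hxy, dist_self] at this
  exact dist_le_zero.1 this

/-- The Jacobian is `√(1 + ‖b‖²)` with `b` the differential of `g` along `L`. The gradient is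
orthogonal to `v`, hence in the range of `L`, so restricting to that range loses nothing of its
norm. -/
theorem normDet_fderiv_graphParam (hv : ‖v‖ = 1) (hLv : ∀ h, inner ℝ v (L h) = 0)
    (hgv : ∀ (x : E (d + 1)) (t : ℝ), g (x + t • v) = g x) {h : E d}
    (hd : DifferentiableAt ℝ g (graphParam L v g h)) :
    (fderiv ℝ (graphParam L v g) h).toLinearMap.normDet = ‖v - gradient g (graphParam L v g h)‖ := by
  set a := gradient g (graphParam L v g h) with ha
  set b := (fderiv ℝ g (graphParam L v g h)).comp L.toContinuousLinearMap with hb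
  have h1 : HasFDerivAt (fun y => L y + g (L h) • v) L.toContinuousLinearMap h :=
    L.toContinuousLinearMap.hasFDerivAt.add_const _
  have h2 : HasFDerivAt (fun y => g (L y + g (L h) • v)) b h :=
    HasFDerivAt.comp (g := g) h hd.hasFDerivAt h1
  simp only [hgv] at h2
  have h3 : HasFDerivAt (graphParam L v g) (L.toContinuousLinearMap + b.smulRight v) h :=
    L.toContinuousLinearMap.hasFDerivAt.add (h2.smul_const v)
  rw [h3.fderiv, normDet_graph L hv hLv]
  have hbn : ‖b‖ = ‖a‖ := by
    have hba : ∀ y, b y = inner ℝ a (L y) := fun y => by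
      rw [hb, ha, inner_gradient_left]; rfl
    refine le_antisymm (b.opNorm_le_bound (norm_nonneg _) fun y => ?_) ?_
    · rw [hba, ← L.norm_map y]
      exact norm_inner_le_norm _ _
    · obtain ⟨y, hy⟩ := surjective_coordinates hv hLv a
      rw [ha, inner_gradient_direction hgv, zero_smul, add_zero, ← ha] at hy
      have h4 := b.le_opNorm y
      rw [hba, hy, real_inner_self_eq_norm_sq, ← L.norm_map y, hy, Real.norm_of_nonneg (by positivity),
        pow_two] at h4
      rcases eq_or_lt_of_le (norm_nonneg a) with h0 | h0
      · rw [← h0]; exact norm_nonneg _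
      · exact le_of_mul_le_mul_right h4 h0
  rw [hbn, ← norm_sub_gradient_sq hv hgv, Real.sqrt_sq (norm_nonneg _)]

/-- The area formula pulls the surface measure back to a density on the parameter space. No
measurability of `ψ` is needed because the parametrization is a measurable embedding. -/
theorem setIntegral_graph (hv : ‖v‖ = 1) (hLv : ∀ h, inner ℝ v (L h) = 0)
    (hmp : MeasurePreserving (fun p : E d × ℝ => L p.1 + p.2 • v) volume volume)
    (hg : LipschitzWith K g) (hgv : ∀ (x : E (d + 1)) (t : ℝ), g (x + t • v) = g x)
    (ψ : E (d + 1) → F) :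
    ∫ x in {x | inner ℝ v x = g x}, ψ x ∂(Measure.euclideanHausdorffMeasure d) =
      ∫ h : E d, ‖v - gradient g (graphParam L v g h)‖ • ψ (graphParam L v g h) := by
  have hemb := measurableEmbedding_graphParam hv hLv hg
  have harea := area_formula (lipschitzWith_graphParam (L := L) hv hg)
    (dist_le_dist_graphParam hv hLv)
  rw [finrank_euclideanSpace_fin] at harea
  have hdens : (volume : Measure (E d)).withDensity
      (fun x => ENNReal.ofReal (fderiv ℝ (graphParam L v g) x).toLinearMap.normDet) =
      volume.withDensity fun h => ENNReal.ofReal ‖v - gradient g (graphParam L v g h)‖ := by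
    refine withDensity_congr_ae ?_
    filter_upwards [ae_differentiableAt_graphParam hmp hg hgv] with h hh
    rw [normDet_fderiv_graphParam hv hLv hgv hh]
  rw [← range_graphParam hv hLv hgv, ← hemb.map_comap, hemb.integral_map, harea, hdens,
    integral_withDensity_eq_integral_toReal_smul]
  · simp only [ENNReal.toReal_ofReal (norm_nonneg _)]
  · have h1 := (measurable_gradient g).comp (continuous_graphParam (L := L) (v := v) hg).measurable
    exact (h1.const_sub v).norm.ennreal_ofReal
  · exact .of_forall fun _ => ENNReal.ofReal_lt_top

theorem ae_differentiableAt_graph (hv : ‖v‖ = 1) (hLv : ∀ h, inner ℝ v (L h) = 0)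
    (hmp : MeasurePreserving (fun p : E d × ℝ => L p.1 + p.2 • v) volume volume)
    (hg : LipschitzWith K g) (hgv : ∀ (x : E (d + 1)) (t : ℝ), g (x + t • v) = g x) :
    ∀ᵐ x ∂((Measure.euclideanHausdorffMeasure d).restrict {x | inner ℝ v x = g x}),
      DifferentiableAt ℝ g x := by
  have hS : MeasurableSet {x | inner ℝ v x = g x} :=
    (isClosed_eq (by fun_prop) hg.continuous).measurableSet
  rw [ae_restrict_iff' hS, ae_iff]
  have h0 := hausdorff_image_eq_zero (lipschitzWith_graphParam (L := L) hv hg)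
    (ae_iff.1 (ae_differentiableAt_graphParam hmp hg hgv))
  rw [finrank_euclideanSpace_fin] at h0
  refine measure_mono_null (fun x hx => ?_) h0
  simp only [mem_ofPred_eq, Classical.not_imp] at hx
  have : x ∈ range (graphParam L v g) := by rw [range_graphParam hv hLv hgv]; exact hx.1
  obtain ⟨h, rfl⟩ := this
  exact ⟨h, hx.2, rfl⟩

/-- The Jacobian `‖v - ∇g‖` cancels the normalization of the unit normal, leaving the weight `⟨u, v
- ∇g⟩` found in the graph coordinates. -/
theorem setIntegral_fderiv_subgraph (hv : ‖v‖ = 1) (hLv : ∀ h, inner ℝ v (L h) = 0)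
    (hmp : MeasurePreserving (fun p : E d × ℝ => L p.1 + p.2 • v) volume volume)
    (hg : LipschitzWith K g) (hgv : ∀ (x : E (d + 1)) (t : ℝ), g (x + t • v) = g x)
    [CompleteSpace F] {φ : E (d + 1) → F} (hφ : ContDiff ℝ 1 φ) (hc : HasCompactSupport φ)
    (u : E (d + 1)) :
    ∫ x in subgraph v g, fderiv ℝ φ x u =
      ∫ x in {x | inner ℝ v x = g x}, inner ℝ u (graphNormal v g x) • φ x
        ∂(Measure.euclideanHausdorffMeasure d) := by
  rw [integrable_and_integral_fderiv_subgraph hv hLv hmp hg hgv hφ hc,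
    setIntegral_graph hv hLv hmp hg hgv]
  refine integral_congr_ae (.of_forall fun h => ?_)
  simp only [smul_smul]
  congr 1
  have hc := norm_sub_gradient_pos hv hgv (graphParam L v g h)
  rw [graphNormal, inner_smul_right, ← mul_assoc, mul_inv_cancel₀ hc.ne', one_mul, inner_sub_right,
    ← inner_gradient_left, real_inner_comm, real_inner_comm u (gradient _ _)]

theorem measure_graph_inter_closedBall_lt_top (hv : ‖v‖ = 1) (hLv : ∀ h, inner ℝ v (L h) = 0)
    (hg : LipschitzWith K g) (hgv : ∀ (x : E (d + 1)) (t : ℝ), g (x + t • v) = g x) (R : ℝ) :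
    Measure.euclideanHausdorffMeasure d ({x | inner ℝ v x = g x} ∩ Metric.closedBall 0 R) < ∞ := by
  have h := hausdorff_image_le_of_dist_le (f := graphParam L v g) (g := id)
    (s := Metric.closedBall 0 R) (C := 1 + K) d
    fun x _ y _ => (lipschitzWith_graphParam (L := L) hv hg).dist_le_mul x y
  rw [image_id, EuclideanSpace.euclideanHausdorffMeasure_eq_volume] at h
  refine lt_of_le_of_lt (measure_mono ?_) (lt_of_le_of_lt h ?_)
  · rintro x ⟨hx, hR⟩
    rw [← range_graphParam hv hLv hgv] at hx
    obtain ⟨h, rfl⟩ := hx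
    refine ⟨h, ?_, rfl⟩
    rw [mem_closedBall_zero_iff] at hR ⊢
    exact (norm_le_norm_coordinates hv hLv h (g (L h))).trans hR
  · exact ENNReal.mul_lt_top (ENNReal.pow_lt_top ENNReal.coe_lt_top)
      (isCompact_closedBall _ _).measure_lt_top

end Graph

section

open scoped Manifold ContDiff

/-! ### The divergence theorem on bounded Lipschitz domains -/

/-- On the open set `U` the set `W` is the region below the graph of the Lipschitz function `g` in
the direction `v`, with adapted coordinates `L`. -/
structure IsGraphChart {d : ℕ} (W U : Set (E (d + 1))) (v : E (d + 1)) (L : E d →ₗᵢ[ℝ] E (d + 1))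
    (g : E (d + 1) → ℝ) (K : ℝ≥0) : Prop where
  isOpen : IsOpen U
  norm_eq : ‖v‖ = 1
  inner_eq : ∀ h, inner ℝ v (L h) = 0
  measurePreserving : MeasurePreserving (fun p : E d × ℝ => L p.1 + p.2 • v) volume volume
  lipschitz : LipschitzWith K g
  invariant : ∀ (x : E (d + 1)) (t : ℝ), g (x + t • v) = g x
  mem_iff : ∀ x ∈ U, (x ∈ W ↔ x ∈ subgraph v g)

theorem frontier_subgraph {n : ℕ} {v : E n} {g : E n → ℝ} (hv : ‖v‖ = 1) (hg : Continuous g)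
    (hgv : ∀ (x : E n) (t : ℝ), g (x + t • v) = g x) :
    frontier (subgraph v g) = {x | inner ℝ v x = g x} := by
  refine Subset.antisymm (frontier_lt_subset_eq (by fun_prop) hg) fun x hx => ?_
  rw [mem_ofPred_eq] at hx
  have hopen : IsOpen (subgraph v g) := isOpen_lt (by fun_prop) hg
  refine ⟨?_, ?_⟩
  · have hlim : Tendsto (fun t : ℝ => x + t • v) (𝓝[<] 0) (𝓝 x) := by
      have : Continuous fun t : ℝ => x + t • v := by fun_prop
      have := this.tendsto 0
      rw [zero_smul, add_zero] at this
      exact this.mono_left nhdsWithin_le_nhds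
    refine mem_closure_of_tendsto hlim ?_
    filter_upwards [self_mem_nhdsWithin] with t ht
    have ht0 : t < 0 := ht
    rw [subgraph, mem_ofPred_eq, hgv, inner_add_right, inner_smul_right,
      real_inner_self_eq_norm_sq, hv, hx]
    linarith
  · rw [hopen.interior_eq, subgraph, mem_ofPred_eq, hx]
    exact lt_irrefl _

theorem IsLipschitzOpen.exists_chart {d : ℕ} {W : Set (E (d + 1))} (hW : IsLipschitzOpen W)
    {p : E (d + 1)} (hp : p ∈ frontier W) :
    ∃ U v L g K, p ∈ U ∧ IsGraphChart W U v L g K := by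
  obtain ⟨U, hU, v, g, K, hv, hg, hgv, hUW⟩ := hW.2 p hp
  obtain ⟨L, hLv, hmp⟩ := exists_adapted_coordinates hv
  exact ⟨interior U, v, L, g, K, mem_interior_iff_mem_nhds.2 hU, isOpen_interior, hv, hLv, hmp, hg,
    hgv, fun x hx => hUW x (interior_subset hx)⟩

section Chart

variable {d : ℕ} {W U : Set (E (d + 1))} {v : E (d + 1)} {L : E d →ₗᵢ[ℝ] E (d + 1)}
  {g : E (d + 1) → ℝ} {K : ℝ≥0} {F : Type*} [NormedAddCommGroup F] [NormedSpace ℝ F]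

theorem IsGraphChart.inter_eq (h : IsGraphChart W U v L g K) : W ∩ U = subgraph v g ∩ U := by
  ext x
  constructor
  · rintro ⟨h1, h2⟩; exact ⟨(h.mem_iff x h2).1 h1, h2⟩
  · rintro ⟨h1, h2⟩; exact ⟨(h.mem_iff x h2).2 h1, h2⟩

theorem IsGraphChart.frontier_inter_eq (h : IsGraphChart W U v L g K) :
    frontier W ∩ U = {x | inner ℝ v x = g x} ∩ U := by
  rw [← frontier_subgraph h.norm_eq h.lipschitz.continuous h.invariant,
    ← frontier_inter_open_inter h.isOpen, h.inter_eq, frontier_inter_open_inter h.isOpen]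

/-- `outerNormal` is defined by choice. Wherever `g` is differentiable, uniqueness of the normal
identifies it with an explicit measurable field, and those points are almost all of the boundary. -/
theorem IsGraphChart.ae_outerNormal_eq (h : IsGraphChart W U v L g K) :
    ∀ᵐ x ∂((Measure.euclideanHausdorffMeasure d).restrict (frontier W ∩ U)),
      outerNormal W x = graphNormal v g x := by
  have h1 := ae_differentiableAt_graph h.norm_eq h.inner_eq h.measurePreserving h.lipschitz
    h.invariant
  have hm : MeasurableSet (frontier W ∩ U) :=
    isClosed_frontier.measurableSet.inter h.isOpen.measurableSet
  have h2 : ∀ᵐ x ∂((Measure.euclideanHausdorffMeasure d).restrict (frontier W ∩ U)),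
      DifferentiableAt ℝ g x := by
    rw [h.frontier_inter_eq]
    exact ae_restrict_of_ae_restrict_of_subset inter_subset_left h1
  filter_upwards [h2, ae_restrict_mem hm] with x hx hxm
  rw [h.frontier_inter_eq] at hxm
  exact outerNormal_eq (isOuterUnitNormal_graphNormal h.norm_eq h.invariant
    (h.isOpen.mem_nhds hxm.2) h.mem_iff hxm.1 hx)

/-- Both integrands vanish off `U`, and inside `U` the set `W` and its frontier coincide with the
subgraph and the graph, so the global graph formula applies. -/
theorem IsGraphChart.setIntegral_fderiv (h : IsGraphChart W U v L g K) (hW : IsOpen W)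
    [CompleteSpace F] {φ : E (d + 1) → F} (hφ : ContDiff ℝ 1 φ) (hc : HasCompactSupport φ)
    (hU : tsupport φ ⊆ U) (u : E (d + 1)) :
    ∫ x in W, fderiv ℝ φ x u =
      ∫ x in frontier W, inner ℝ u (outerNormal W x) • φ x
        ∂(Measure.euclideanHausdorffMeasure d) := by
  have hz : ∀ x ∉ U, φ x = 0 := fun x hx => by
    by_contra h0
    exact hx (hU (subset_tsupport _ h0))
  have hz' : ∀ x ∉ U, fderiv ℝ φ x u = 0 := fun x hx => by
    by_contra h0
    exact hx (hU (tsupport_fderiv_apply_subset ℝ u (subset_tsupport _ h0)))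
  have hUm := h.isOpen.measurableSet
  have hSm : MeasurableSet {x | inner ℝ v x = g x} :=
    (isClosed_eq (by fun_prop) h.lipschitz.continuous).measurableSet
  have hΩm : MeasurableSet (subgraph v g) :=
    (isOpen_lt (by fun_prop) h.lipschitz.continuous).measurableSet
  rw [setIntegral_eq_of_subset_of_forall_sdiff_eq_zero hW.measurableSet
      (inter_subset_left (s := W) (t := U)) (fun x hx => hz' x fun hxU => hx.2 ⟨hx.1, hxU⟩),
    h.inter_eq,
    ← setIntegral_eq_of_subset_of_forall_sdiff_eq_zero hΩm
      (inter_subset_left (s := subgraph v g) (t := U))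
      (fun x hx => hz' x fun hxU => hx.2 ⟨hx.1, hxU⟩),
    setIntegral_fderiv_subgraph h.norm_eq h.inner_eq h.measurePreserving h.lipschitz h.invariant
      hφ hc,
    setIntegral_eq_of_subset_of_forall_sdiff_eq_zero hSm
      (inter_subset_left (s := {x | inner ℝ v x = g x}) (t := U))
      (fun x hx => by rw [hz x fun hxU => hx.2 ⟨hx.1, hxU⟩, smul_zero]),
    ← h.frontier_inter_eq,
    setIntegral_eq_of_subset_of_forall_sdiff_eq_zero isClosed_frontier.measurableSet
      (inter_subset_left (s := frontier W) (t := U))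
      (fun x hx => by rw [hz x fun hxU => hx.2 ⟨hx.1, hxU⟩, smul_zero])]
  refine integral_congr_ae ?_
  filter_upwards [h.ae_outerNormal_eq] with x hx
  rw [hx]

end Chart

section Domain

variable {d : ℕ} {W : Set (E (d + 1))} {F : Type*} [NormedAddCommGroup F] [NormedSpace ℝ F]

theorem isCompact_frontier_of_isBounded {n : ℕ} {W : Set (E n)} (hb : Bornology.IsBounded W) :
    IsCompact (frontier W) :=
  (Metric.isCompact_of_isClosed_isBounded isClosed_closure hb.closure).of_isClosed_subset
    isClosed_frontier frontier_subset_closure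

theorem isFiniteMeasure_surfaceMeasure (hW : IsLipschitzOpen W) (hb : Bornology.IsBounded W) :
    IsFiniteMeasure (surfaceMeasure W) := by
  refine ⟨?_⟩
  rw [surfaceMeasure, Measure.restrict_apply_univ, Nat.add_sub_cancel]
  refine (isCompact_frontier_of_isBounded hb).measure_lt_top_of_nhdsWithin fun p hp => ?_
  obtain ⟨U, v, L, g, K, hpU, h⟩ := hW.exists_chart hp
  refine ⟨frontier W ∩ (U ∩ Metric.ball 0 (‖p‖ + 1)), ?_, ?_⟩
  · refine inter_mem_nhdsWithin _ ((h.isOpen.inter Metric.isOpen_ball).mem_nhds ⟨hpU, ?_⟩)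
    rw [mem_ball_zero_iff]; linarith
  · refine lt_of_le_of_lt (measure_mono ?_) (measure_graph_inter_closedBall_lt_top h.norm_eq
      h.inner_eq h.lipschitz h.invariant (‖p‖ + 1))
    rintro x ⟨h1, h2, h3⟩
    have : x ∈ {x | inner ℝ v x = g x} ∩ U := by rw [← h.frontier_inter_eq]; exact ⟨h1, h2⟩
    exact ⟨this.1, Metric.ball_subset_closedBall h3⟩

/-- By the Lindelöf property countably many charts cover the frontier, and on each the normal agrees
almost everywhere with a measurable graph normal. -/
theorem aestronglyMeasurable_outerNormal (hW : IsLipschitzOpen W) :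
    AEStronglyMeasurable (outerNormal W) (surfaceMeasure W) := by
  rw [surfaceMeasure, Nat.add_sub_cancel]
  have hex : ∀ p : E (d + 1), ∃ U v L g K, p ∈ frontier W →
      p ∈ U ∧ IsGraphChart (d := d) W U v L g K := fun p => by
    by_cases hp : p ∈ frontier W
    · obtain ⟨U, v, L, g, K, h⟩ := hW.exists_chart hp
      exact ⟨U, v, L, g, K, fun _ => h⟩
    -- Dummy values off the frontier, needed only to make the choice total.
    · exact ⟨univ, 0, consZero d, 0, 0, fun h => absurd h hp⟩
  choose U v L g K h using hex
  obtain ⟨t, hts, htc, hcov⟩ := TopologicalSpace.countable_cover_nhdsWithin (s := frontier W)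
    (f := U) fun p hp => mem_nhdsWithin_of_mem_nhds ((h p hp).2.isOpen.mem_nhds (h p hp).1)
  have : frontier W = ⋃ p ∈ t, frontier W ∩ U p := by
    rw [← inter_iUnion₂]
    exact (inter_eq_left.2 hcov).symm
  have := htc.to_subtype
  rw [‹frontier W = _›, biUnion_eq_iUnion, aestronglyMeasurable_iUnion_iff]
  exact fun ⟨p, hp⟩ => ((measurable_graphNormal (v p) (g p)).stronglyMeasurable.aestronglyMeasurable).congr
    ((h p (hts hp)).2.ae_outerNormal_eq.mono fun x hx => hx.symm)

theorem integrable_surface_of_continuousOn (hW : IsLipschitzOpen W) (hb : Bornology.IsBounded W)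
    {φ : E (d + 1) → F} (hφ : ContinuousOn φ (frontier W)) :
    Integrable φ (surfaceMeasure W) := by
  have := isFiniteMeasure_surfaceMeasure hW hb
  have hc := isCompact_frontier_of_isBounded hb
  obtain ⟨M, hM⟩ := hc.exists_bound_of_continuousOn hφ
  refine Integrable.of_bound (hφ.aestronglyMeasurable_of_isCompact hc hc.measurableSet) M ?_
  exact (ae_restrict_mem hc.measurableSet).mono hM

theorem integrable_inner_outerNormal_smul (hW : IsLipschitzOpen W) (hb : Bornology.IsBounded W)
    {φ : E (d + 1) → F} (hφ : ContinuousOn φ (frontier W)) (u : E (d + 1)) :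
    Integrable (fun x => inner ℝ u (outerNormal W x) • φ x) (surfaceMeasure W) := by
  refine (integrable_surface_of_continuousOn hW hb hφ).bdd_smul (C := ‖u‖)
    (aestronglyMeasurable_const.inner (aestronglyMeasurable_outerNormal hW)) ?_
  · refine .of_forall fun x => (norm_inner_le_norm _ _).trans ?_
    exact mul_le_of_le_one_right (norm_nonneg _) (norm_outerNormal_le W x)

/-- The integral of `φ` over the whole space does not change under translation, so its derivative
vanishes. -/
theorem setIntegral_fderiv_of_tsupport_subset {n : ℕ} {W : Set (E n)} [CompleteSpace F]
    {φ : E n → F} (hφ : ContDiff ℝ 1 φ) (hc : HasCompactSupport φ) (hU : tsupport φ ⊆ W)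
    (u : E n) : ∫ x in W, fderiv ℝ φ x u = 0 := by
  have h1 := hasDerivAt_setIntegral_shift volume hφ hc univ u
  simp only [Measure.restrict_univ] at h1
  have h2 : (fun s : ℝ => ∫ x, φ (x + s • u)) = fun _ => ∫ x, φ x := by
    funext s
    exact integral_add_right_eq_self φ (s • u)
  rw [h2] at h1
  have h3 := h1.unique (hasDerivAt_const _ _)
  rw [← h3, ← Measure.restrict_univ (μ := (volume : Measure (E n))), Measure.restrict_univ]
  symm
  rw [← setIntegral_univ]
  refine setIntegral_eq_of_subset_of_forall_sdiff_eq_zero MeasurableSet.univ (subset_univ _)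
    fun x hx => ?_
  by_contra h0
  exact hx.2 (hU (tsupport_fderiv_apply_subset ℝ u (subset_tsupport _ h0)))

theorem setIntegral_fderiv_of_hasCompactSupport (hW : IsLipschitzOpen W)
    (hb : Bornology.IsBounded W) [CompleteSpace F] {φ : E (d + 1) → F} (hφ : ContDiff ℝ 1 φ)
    (hc : HasCompactSupport φ) (u : E (d + 1)) :
    ∫ x in W, fderiv ℝ φ x u =
      ∫ x, inner ℝ u (outerNormal W x) • φ x ∂(surfaceMeasure W) := by
  have hex : ∀ p : E (d + 1), ∃ U v L g K, p ∈ frontier W →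
      p ∈ U ∧ IsGraphChart (d := d) W U v L g K := fun p => by
    by_cases hp : p ∈ frontier W
    · obtain ⟨U, v, L, g, K, h⟩ := hW.exists_chart hp
      exact ⟨U, v, L, g, K, fun _ => h⟩
    · exact ⟨univ, 0, consZero d, 0, 0, fun h => absurd h hp⟩
  choose U v L g K h using hex
  obtain ⟨t, hts, hcov⟩ := (isCompact_frontier_of_isBounded hb).elim_nhds_subcover U
    fun p hp => (h p hp).2.isOpen.mem_nhds (h p hp).1
  -- The interior patch `none` contributes zero on both sides; the finitely many others are graph
  -- charts along the frontier.
  let V : Option t → Set (E (d + 1)) := fun i => i.elim W fun p => U p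
  have hVo : ∀ i, IsOpen (V i) := by
    rintro (_ | p)
    · exact hW.1
    · exact (h p (hts p p.2)).2.isOpen
  have hVc : closure W ⊆ ⋃ i, V i := by
    intro x hx
    by_cases hxW : x ∈ W
    · exact mem_iUnion.2 ⟨none, hxW⟩
    · have hxf : x ∈ frontier W := ⟨hx, by rwa [hW.1.interior_eq]⟩
      obtain ⟨p, hp, hxp⟩ := mem_iUnion₂.1 (hcov hxf)
      exact mem_iUnion.2 ⟨some ⟨p, hp⟩, hxp⟩
  obtain ⟨ρ, hρ⟩ := SmoothPartitionOfUnity.exists_isSubordinate 𝓘(ℝ, E (d + 1)) isClosed_closure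
    V hVo hVc
  let ψ : Option t → E (d + 1) → F := fun i x => ρ i x • φ x
  have hρd : ∀ i, ContDiff ℝ 1 (ρ i) := fun i =>
    (contMDiff_iff_contDiff.1 (ρ i).contMDiff).of_le (by exact_mod_cast le_top)
  have hψ : ∀ i, ContDiff ℝ 1 (ψ i) := fun i => (hρd i).smul hφ
  have hψc : ∀ i, HasCompactSupport (ψ i) := fun i => hc.smul_left
  have hψs : ∀ i, tsupport (ψ i) ⊆ V i := fun i =>
    (tsupport_smul_subset_left _ _).trans (hρ i)
  have hsum : ∀ x ∈ closure W, ∑ i, ψ i x = φ x := by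
    intro x hx
    have := ρ.sum_eq_one hx
    rw [finsum_eq_sum_of_fintype] at this
    simp only [ψ]
    rw [← Finset.sum_smul, this, one_smul]
  have hloc : ∀ i, ∫ x in W, fderiv ℝ (ψ i) x u =
      ∫ x, inner ℝ u (outerNormal W x) • ψ i x ∂(surfaceMeasure W) := by
    rintro (_ | p)
    · rw [setIntegral_fderiv_of_tsupport_subset (W := W) (hψ none) (hψc none) (hψs none),
        surfaceMeasure,
        setIntegral_eq_zero_of_forall_eq_zero]
      intro x hx
      rw [hW.1.frontier_eq] at hx
      have : ψ none x = 0 := by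
        by_contra h0
        exact hx.2 (hψs none (subset_tsupport _ h0))
      rw [this, smul_zero]
    · rw [surfaceMeasure, Nat.add_sub_cancel]
      exact (h p (hts p p.2)).2.setIntegral_fderiv hW.1 (hψ _) (hψc _) (hψs (some p)) u
  have hi1 : ∀ i ∈ Finset.univ, Integrable (fun x => fderiv ℝ (ψ i) x u) (volume.restrict W) :=
    fun i _ => ((((hψ i).continuous_fderiv one_ne_zero).clm_apply
      continuous_const).integrable_of_hasCompactSupport ((hψc i).fderiv_apply (𝕜 := ℝ) u)).integrableOn
  have hi2 : ∀ i ∈ Finset.univ, Integrable (fun x => inner ℝ u (outerNormal W x) • ψ i x)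
      (surfaceMeasure W) :=
    fun i _ => integrable_inner_outerNormal_smul hW hb (hψ i).continuous.continuousOn u
  calc ∫ x in W, fderiv ℝ φ x u = ∫ x in W, ∑ i, fderiv ℝ (ψ i) x u := by
        refine setIntegral_congr_fun hW.1.measurableSet fun x hx => ?_
        have heq : φ =ᶠ[𝓝 x] fun y => ∑ i, ψ i y := by
          filter_upwards [hW.1.mem_nhds hx] with y hy
          exact (hsum y (subset_closure hy)).symm
        rw [heq.fderiv_eq, fderiv_fun_sum fun i _ => (hψ i).differentiable one_ne_zero x,
          sum_apply]
    _ = ∑ i, ∫ x in W, fderiv ℝ (ψ i) x u := integral_finsetSum _ hi1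
    _ = ∑ i, ∫ x, inner ℝ u (outerNormal W x) • ψ i x ∂(surfaceMeasure W) :=
        Finset.sum_congr rfl fun i _ => hloc i
    _ = ∫ x, ∑ i, inner ℝ u (outerNormal W x) • ψ i x ∂(surfaceMeasure W) :=
        (integral_finsetSum _ hi2).symm
    _ = _ := by
        refine setIntegral_congr_fun isClosed_frontier.measurableSet fun x hx => ?_
        rw [← Finset.smul_sum, hsum x (frontier_subset_closure hx)]

/-- The divergence theorem on a bounded Lipschitz domain, for functions of class `C¹` on an open
neighbourhood of the closure. -/
theorem setIntegral_fderiv_eq_surface (hW : IsLipschitzOpen W) (hb : Bornology.IsBounded W)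
    [CompleteSpace F] {φ : E (d + 1) → F} {O : Set (E (d + 1))} (hO : IsOpen O)
    (hWO : closure W ⊆ O) (hφ : ContDiffOn ℝ 1 φ O) (u : E (d + 1)) :
    IntegrableOn (fun x => fderiv ℝ φ x u) W ∧ ∫ x in W, fderiv ℝ φ x u =
      ∫ x, inner ℝ u (outerNormal W x) • φ x ∂(surfaceMeasure W) := by
  have hcW : IsCompact (closure W) :=
    Metric.isCompact_of_isClosed_isBounded isClosed_closure hb.closure
  obtain ⟨C, hC, hWC, hCO⟩ := exists_compact_between hcW hO hWO
  -- Multiplying by a cutoff equal to `1` near `closure W` makes `φ` globally `C¹` with compact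
  -- support, without changing it or its derivative where they are integrated.
  obtain ⟨η, hη1, hη0, -⟩ := exists_contMDiffMap_one_nhds_of_subset_interior (n := 1)
    𝓘(ℝ, E (d + 1)) (isClosed_closure (s := W)) hWC
  have hηd : ContDiff ℝ 1 η := contMDiff_iff_contDiff.1 η.contMDiff
  have hηs : tsupport η ⊆ C := by
    refine closure_minimal (fun x hx => ?_) hC.isClosed
    by_contra h0
    exact hx (hη0 x h0)
  have hd : ContDiff ℝ 1 fun x => η x • φ x := by
    rw [contDiff_iff_contDiffAt]
    intro x
    by_cases hx : x ∈ O
    · exact hηd.contDiffAt.smul (hφ.contDiffAt (hO.mem_nhds hx))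
    · have : (fun x => η x • φ x) =ᶠ[𝓝 x] fun _ => 0 := by
        have : (tsupport η)ᶜ ∈ 𝓝 x :=
          (isClosed_tsupport η).isOpen_compl.mem_nhds fun h => hx (hCO (hηs h))
        filter_upwards [this] with y hy
        rw [image_eq_zero_of_notMem_tsupport hy, zero_smul]
      exact contDiffAt_const.congr_of_eventuallyEq this
  have hcs : HasCompactSupport fun x => η x • φ x :=
    HasCompactSupport.smul_right (hC.of_isClosed_subset (isClosed_tsupport _) hηs)
  have key := setIntegral_fderiv_of_hasCompactSupport hW hb hd hcs u
  have hev : ∀ x ∈ closure W, (fun x => η x • φ x) =ᶠ[𝓝 x] φ := by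
    intro x hx
    have := (eventually_nhdsSet_iff_forall.1 hη1) x hx
    filter_upwards [this] with y hy
    rw [hy, one_smul]
  have hfd : ∀ x ∈ W, fderiv ℝ (fun x => η x • φ x) x u = fderiv ℝ φ x u := fun x hx => by
    rw [(hev x (subset_closure hx)).fderiv_eq]
  constructor
  · have h1 : IntegrableOn (fun x => fderiv ℝ (fun x => η x • φ x) x u) W :=
      (((hd.continuous_fderiv one_ne_zero).clm_apply
        continuous_const).integrable_of_hasCompactSupport (hcs.fderiv_apply (𝕜 := ℝ) u)).integrableOn
    exact h1.congr_fun hfd hW.1.measurableSet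
  · rw [setIntegral_congr_fun hW.1.measurableSet hfd] at key
    rw [key]
    refine setIntegral_congr_fun isClosed_frontier.measurableSet fun x hx => ?_
    rw [(hev x (frontier_subset_closure hx)).eq_of_nhds]

end Domain

end

/-! ### Calculus in the Clifford algebra -/

instance (n : ℕ) : CompleteSpace (Cl n) := FiniteDimensional.complete ℝ (Cl n)

/-- The multiplication of `Cl_n` as a continuous bilinear map. -/
def mulL (n : ℕ) : Cl n →L[ℝ] Cl n →L[ℝ] Cl n :=
  LinearMap.toContinuousLinearMap
    ((LinearMap.toContinuousLinearMap : (Cl n →ₗ[ℝ] Cl n) ≃ₗ[ℝ] (Cl n →L[ℝ] Cl n)).toLinearMap ∘ₗ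
      LinearMap.mul ℝ (Cl n))

/-- The inclusion of `ℝⁿ` in `Cl_n` as a continuous linear map. -/
def vecL (n : ℕ) : E n →L[ℝ] Cl n :=
  LinearMap.toContinuousLinearMap (CliffordAlgebra.ι (cliffordForm n))

theorem mulL_apply {n : ℕ} (a b : Cl n) : mulL n a b = a * b := rfl

theorem vecL_apply {n : ℕ} (x : E n) : vecL n x = vec x := rfl

theorem norm_mul_le_mulL {n : ℕ} (a b : Cl n) : ‖a * b‖ ≤ ‖mulL n‖ * ‖a‖ * ‖b‖ :=
  (mulL n).le_opNorm₂ a b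

theorem vec_mul_vec_self {n : ℕ} (x : E n) : vec x * vec x = (-‖x‖ ^ 2) • (1 : Cl n) := by
  rw [CliffordAlgebra.ι_sq_scalar, Algebra.algebraMap_eq_smul_one]
  congr 1
  simp [cliffordForm]

theorem sum_smul_e {n : ℕ} (x : E n) : ∑ i, x i • e n i = x := by
  have := (EuclideanSpace.basisFun (Fin n) ℝ).sum_repr x
  simpa using this

theorem inner_e {n : ℕ} (i : Fin n) (x : E n) : inner ℝ (e n i) x = x i := by
  rw [EuclideanSpace.inner_single_left]; simp

theorem sum_smul_vec_e {n : ℕ} (x : E n) : ∑ i, x i • vec (e n i) = vec x := by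
  conv_rhs => rw [← sum_smul_e x]
  simp only [vec, map_sum, map_smul]

theorem sum_vec_e_mul_self (n : ℕ) :
    ∑ i : Fin n, vec (e n i) * vec (e n i) = (-(n : ℝ)) • (1 : Cl n) := by
  simp only [vec_mul_vec_self, PiLp.norm_single, norm_one, one_pow, Finset.sum_const,
    Finset.card_univ, Fintype.card_fin]
  rw [← Nat.cast_smul_eq_nsmul ℝ, smul_smul]
  congr 1
  ring

section Mul

variable {X : Type*} [NormedAddCommGroup X] [NormedSpace ℝ X] {n : ℕ} {A B : X → Cl n}

theorem fderiv_mul_apply {x : X} (hA : DifferentiableAt ℝ A x) (hB : DifferentiableAt ℝ B x)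
    (u : X) :
    fderiv ℝ (fun y => A y * B y) x u = A x * fderiv ℝ B x u + fderiv ℝ A x u * B x := by
  have := (mulL n).hasFDerivAt_of_bilinear hA.hasFDerivAt hB.hasFDerivAt
  simp only [mulL_apply] at this
  rw [this.fderiv]
  rfl

theorem contDiffAt_mul {k : WithTop ℕ∞} {x : X} (hA : ContDiffAt ℝ k A x)
    (hB : ContDiffAt ℝ k B x) : ContDiffAt ℝ k (fun y => A y * B y) x :=
  (mulL n).isBoundedBilinearMap.contDiff.contDiffAt.comp x (hA.prodMk hB)

end Mul

section MulContinuous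

variable {X : Type*} [TopologicalSpace X] {n : ℕ} {A B : X → Cl n}

theorem continuousOn_mul {s : Set X} (hA : ContinuousOn A s) (hB : ContinuousOn B s) :
    ContinuousOn (fun y => A y * B y) s :=
  (mulL n).isBoundedBilinearMap.continuous.comp_continuousOn (hA.prodMk hB)

end MulContinuous

/-- The Dirac operator acting from the right, `f D = ∑ⱼ ∂f/∂x_j e_j`. -/
def rightDirac (n : ℕ) (f : E n → Cl n) : E n → Cl n :=
  fun x => ∑ j : Fin n, fderiv ℝ f x (e n j) * vec (e n j)

/-- The Leibniz rule for the divergence of the fields `A e_j B`. -/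
theorem sum_fderiv_mul_vec_mul {n : ℕ} {A B : E n → Cl n} {x : E n}
    (hA : DifferentiableAt ℝ A x) (hB : DifferentiableAt ℝ B x) :
    ∑ i, fderiv ℝ (fun y => A y * vec (e n i) * B y) x (e n i) =
      rightDirac n A x * B x + A x * dirac n B x := by
  rw [rightDirac, dirac, Finset.sum_mul, Finset.mul_sum, ← Finset.sum_add_distrib]
  refine Finset.sum_congr rfl fun i _ => ?_
  have h1 : DifferentiableAt ℝ (fun y => A y * vec (e n i)) x :=
    (((mulL n).flip (vec (e n i))).differentiableAt).comp x hA
  rw [fderiv_mul_apply h1 hB, fderiv_mul_apply hA (differentiableAt_const _)]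
  simp only [fderiv_fun_const, Pi.zero_apply, zero_apply, mul_zero, zero_add]
  rw [add_comm, mul_assoc (A x)]

theorem contDiffOn_dirac {n : ℕ} {f : E n → Cl n} {V : Set (E n)} (hV : IsOpen V) {k : ℕ}
    (hf : ContDiffOn ℝ (k + 1 : ℕ) f V) : ContDiffOn ℝ k (dirac n f) V := by
  refine ContDiffOn.sum fun j _ => ?_
  have h1 : ContDiffOn ℝ k (fun x => fderiv ℝ f x (e n j)) V :=
    (hf.fderiv_of_isOpen hV (by exact_mod_cast le_rfl)).clm_apply contDiffOn_const
  exact ((mulL n (vec (e n j))).contDiff).comp_contDiffOn h1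

theorem contDiffOn_dirac_iterate {n : ℕ} {f : E n → Cl n} {V : Set (E n)} (hV : IsOpen V) {q : ℕ}
    (hf : ContDiffOn ℝ q f V) {j : ℕ} (hj : j ≤ q) :
    ContDiffOn ℝ (q - j : ℕ) ((dirac n)^[j] f) V := by
  induction j with
  | zero => simpa using hf
  | succ j ih =>
    rw [Function.iterate_succ_apply']
    refine contDiffOn_dirac hV ?_
    have := ih (by omega)
    rwa [show q - j = q - (j + 1) + 1 by omega] at this

theorem dirac_congr {n : ℕ} {f g : E n → Cl n} {V : Set (E n)} (hV : IsOpen V) (h : EqOn f g V) :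
    EqOn (dirac n f) (dirac n g) V := by
  intro x hx
  have : f =ᶠ[𝓝 x] g := h.eventuallyEq_of_mem (hV.mem_nhds hx)
  simp only [dirac, this.fderiv_eq]

theorem dirac_iterate_congr {n : ℕ} {f g : E n → Cl n} {V : Set (E n)} (hV : IsOpen V)
    (h : EqOn f g V) (j : ℕ) : EqOn ((dirac n)^[j] f) ((dirac n)^[j] g) V := by
  induction j with
  | zero => exact h
  | succ j ih =>
    rw [Function.iterate_succ_apply', Function.iterate_succ_apply']
    exact dirac_congr hV ih

/-! ### The fundamental solutions -/

theorem hasFDerivAt_norm_zpow {n : ℕ} (s : ℤ) {x : E n} (hx : x ≠ 0) :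
    HasFDerivAt (fun y : E n => ‖y‖ ^ s) ((s * ‖x‖ ^ (s - 2)) • innerSL ℝ x) x := by
  have hx0 : ‖x‖ ≠ 0 := norm_ne_zero_iff.2 hx
  have h1 := (hasStrictFDerivAt_norm_sq x).hasFDerivAt.sqrt (pow_ne_zero 2 hx0)
  simp only [Real.sqrt_sq (norm_nonneg _)] at h1
  have h2 := (hasDerivAt_zpow s ‖x‖ (Or.inl hx0)).comp_hasFDerivAt x h1
  refine h2.congr_fderiv ?_
  ext u
  simp only [smul_apply, smul_eq_mul, nsmul_eq_mul]
  rw [zpow_sub₀ hx0, zpow_sub₀ hx0]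
  push_cast
  field_simp

theorem contDiffAt_norm_zpow {n : ℕ} (s : ℤ) {x : E n} (hx : x ≠ 0) {k : WithTop ℕ∞} :
    ContDiffAt ℝ k (fun y : E n => ‖y‖ ^ s) x := by
  have h1 : ContDiffAt ℝ k (fun y : E n => ‖y‖) x := contDiffAt_norm ℝ hx
  obtain ⟨m, rfl | rfl⟩ := s.eq_nat_or_neg
  · simpa using h1.pow m
  · simp only [zpow_neg, zpow_natCast]
    exact (h1.pow m).inv (pow_ne_zero m (norm_ne_zero_iff.2 hx))

theorem contDiffAt_G (n p : ℕ) {x : E n} (hx : x ≠ 0) {k : WithTop ℕ∞} :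
    ContDiffAt ℝ k (G n p) x := by
  by_cases hp : Even p
  · have : G n p = fun y => (fundCoeff n p * ‖y‖ ^ ((p : ℤ) - (n : ℤ))) • (1 : Cl n) := by
      funext y
      rw [G, if_pos hp, Algebra.algebraMap_eq_smul_one]
    rw [this]
    exact (contDiffAt_const.mul (contDiffAt_norm_zpow _ hx)).smul
      (contDiffAt_const (c := (1 : Cl n)))
  · have : G n p = fun y => -(fundCoeff n p * ‖y‖ ^ ((p : ℤ) - (n : ℤ) - 1)) • vecL n y := by
      funext y
      rw [G, if_neg hp, vecL_apply]
    rw [this]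
    exact ((contDiffAt_const.mul (contDiffAt_norm_zpow _ hx)).neg).smul (vecL n).contDiff.contDiffAt

theorem rightDirac_G_of_even {n p : ℕ} (hp : Even p) {x : E n} (hx : x ≠ 0) :
    rightDirac n (G n p) x =
      (fundCoeff n p * ((p : ℝ) - n) * ‖x‖ ^ ((p : ℤ) - (n : ℤ) - 2)) • vec x := by
  have hfun : G n p = fun y => (fundCoeff n p * ‖y‖ ^ ((p : ℤ) - (n : ℤ))) • (1 : Cl n) := by
    funext y
    rw [G, if_pos hp, Algebra.algebraMap_eq_smul_one]
  have hd := ((hasFDerivAt_norm_zpow ((p : ℤ) - (n : ℤ)) hx).const_mul (fundCoeff n p)).smul_const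
    (1 : Cl n)
  rw [hfun, rightDirac, hd.fderiv, ← sum_smul_vec_e x, Finset.smul_sum]
  refine Finset.sum_congr rfl fun i _ => ?_
  simp only [ContinuousLinearMap.smulRight_apply, smul_apply, innerSL_apply_apply, smul_eq_mul]
  rw [real_inner_comm, inner_e, smul_mul_assoc, one_mul, smul_smul]
  congr 1
  push_cast
  ring

/-- With `s = p - n - 1`, the identities `∑ e_i e_i = -n` and `x x = -‖x‖²` combine to the factor `n
+ s = p - 1`. In particular it vanishes for `p = 1`. -/
theorem rightDirac_G_of_odd {n p : ℕ} (hp : ¬ Even p) {x : E n} (hx : x ≠ 0) :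
    rightDirac n (G n p) x =
      (fundCoeff n p * ((p : ℝ) - 1) * ‖x‖ ^ ((p : ℤ) - (n : ℤ) - 1)) • (1 : Cl n) := by
  have hx0 : ‖x‖ ≠ 0 := norm_ne_zero_iff.2 hx
  have hfun : G n p = fun y => -(fundCoeff n p * ‖y‖ ^ ((p : ℤ) - (n : ℤ) - 1)) • vecL n y := by
    funext y
    rw [G, if_neg hp, vecL_apply]
  set s := (p : ℤ) - (n : ℤ) - 1 with hs
  have hd : HasFDerivAt (fun y => -(fundCoeff n p * ‖y‖ ^ s) • vecL n y)
      (-(fundCoeff n p * ‖x‖ ^ s) • vecL n +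
        (-(fundCoeff n p • ((s : ℝ) * ‖x‖ ^ (s - 2)) • innerSL ℝ x)).smulRight (vecL n x)) x :=
    (((hasFDerivAt_norm_zpow s hx).const_mul (fundCoeff n p)).neg).smul (vecL n).hasFDerivAt
  rw [hfun, rightDirac]
  have hterm : ∀ i : Fin n,
      fderiv ℝ (fun y => -(fundCoeff n p * ‖y‖ ^ s) • vecL n y) x (e n i) * vec (e n i) =
        (-(fundCoeff n p * ‖x‖ ^ s)) • (vec (e n i) * vec (e n i)) +
        (-(fundCoeff n p * (s * ‖x‖ ^ (s - 2)))) • (vec x * (x i • vec (e n i))) := by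
    intro i
    rw [hd.fderiv]
    simp only [add_apply, smul_apply, ContinuousLinearMap.smulRight_apply, neg_apply,
      innerSL_apply_apply, vecL_apply, smul_eq_mul]
    rw [real_inner_comm, inner_e, add_mul, smul_mul_assoc, smul_mul_assoc, mul_smul_comm, smul_smul]
    congr 2
    ring
  simp only [hterm]
  rw [Finset.sum_add_distrib, ← Finset.smul_sum, ← Finset.smul_sum, ← Finset.mul_sum,
    sum_vec_e_mul_self, sum_smul_vec_e, vec_mul_vec_self, smul_smul, smul_smul, ← add_smul]
  congr 1
  have h2 : ‖x‖ ^ (s - 2) * ‖x‖ ^ 2 = ‖x‖ ^ s := by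
    rw [zpow_sub₀ hx0]
    field_simp
  have h3 : (s : ℝ) = (p : ℝ) - n - 1 := by rw [hs]; push_cast; ring
  calc _ = fundCoeff n p * (n * ‖x‖ ^ s + s * (‖x‖ ^ (s - 2) * ‖x‖ ^ 2)) := by ring
    _ = _ := by rw [h2, h3]; ring

theorem rightDirac_G_one {n : ℕ} {x : E n} (hx : x ≠ 0) : rightDirac n (G n 1) x = 0 := by
  rw [rightDirac_G_of_odd (by decide) hx]
  simp

/-- The recursion for the constants is designed for this. When `p + 1` is even, differentiation
produces `p + 1 - n`, whose sign matches the minus sign in the odd kernels; when it is odd, it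
produces `p`. The bound `p + 1 < n` keeps the denominator nonzero. -/
theorem rightDirac_G_succ {n p : ℕ} (hp : 1 ≤ p) (hpn : p + 1 < n) {x : E n} (hx : x ≠ 0) :
    rightDirac n (G n (p + 1)) x = G n p x := by
  obtain ⟨k, rfl⟩ := Nat.exists_eq_add_of_le' hp
  have hc : fundCoeff n (k + 1 + 1) =
      fundCoeff n (k + 1) / (if Even k then (n : ℝ) - ((k : ℝ) + 2) else (k : ℝ) + 1) := rfl
  by_cases hk : Even k
  · have h1 : Even (k + 1 + 1) := by rw [add_assoc]; exact hk.add even_two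
    have h2 : ¬ Even (k + 1) := by rw [Nat.even_add_one]; exact not_not.2 hk
    rw [rightDirac_G_of_even h1 hx, G, if_neg h2, hc, if_pos hk]
    congr 1
    have h3 : (n : ℝ) - (k + 2) ≠ 0 := by
      have : ((k + 1 + 1 : ℕ) : ℝ) < n := by exact_mod_cast hpn
      push_cast at this
      linarith
    have h4 : ((k + 1 + 1 : ℕ) : ℤ) - (n : ℤ) - 2 = ((k + 1 : ℕ) : ℤ) - n - 1 := by
      push_cast; ring
    rw [h4]
    push_cast
    field_simp
    ring
  · have h1 : ¬ Even (k + 1 + 1) := by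
      rw [Nat.even_add_one, Nat.even_add_one]; exact not_not.2 hk
    have h2 : Even (k + 1) := by rw [Nat.even_add_one]; exact hk
    rw [rightDirac_G_of_odd h1 hx, G, if_pos h2, hc, if_neg hk, Algebra.algebraMap_eq_smul_one]
    congr 1
    have h4 : ((k + 1 + 1 : ℕ) : ℤ) - (n : ℤ) - 1 = ((k + 1 : ℕ) : ℤ) - n := by
      push_cast; ring
    rw [h4]
    push_cast
    field_simp
    ring

theorem G_smul (n p : ℕ) {t : ℝ} (ht : 0 < t) (x : E n) :
    G n p (t • x) = t ^ ((p : ℤ) - (n : ℤ)) • G n p x := by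
  unfold G
  split_ifs with hp
  · rw [Algebra.algebraMap_eq_smul_one, Algebra.algebraMap_eq_smul_one, smul_smul, norm_smul,
      Real.norm_of_nonneg ht.le, mul_zpow]
    congr 1
    ring
  · rw [vec, map_smul, smul_smul, smul_smul, norm_smul, Real.norm_of_nonneg ht.le, mul_zpow]
    congr 1
    have : t ^ ((p : ℤ) - (n : ℤ)) = t ^ ((p : ℤ) - (n : ℤ) - 1) * t := by
      rw [← zpow_add_one₀ ht.ne']; congr 1; ring
    rw [this]
    ring

theorem exists_norm_G_le (n p : ℕ) :
    ∃ C, 0 ≤ C ∧ ∀ x : E n, x ≠ 0 → ‖G n p x‖ ≤ C * ‖x‖ ^ ((p : ℤ) - (n : ℤ)) := by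
  by_cases hp : Even p
  · refine ⟨|fundCoeff n p| * ‖(1 : Cl n)‖, by positivity, fun x hx => le_of_eq ?_⟩
    rw [G, if_pos hp, Algebra.algebraMap_eq_smul_one, norm_smul, norm_mul, Real.norm_eq_abs,
      Real.norm_of_nonneg (zpow_nonneg (norm_nonneg x) _)]
    ring
  · refine ⟨|fundCoeff n p| * ‖vecL n‖, by positivity, fun x hx => ?_⟩
    rw [G, if_neg hp, norm_smul, norm_neg, norm_mul, Real.norm_eq_abs,
      Real.norm_of_nonneg (zpow_nonneg (norm_nonneg x) _)]
    have h1 : ‖vec x‖ ≤ ‖vecL n‖ * ‖x‖ := (vecL n).le_opNorm x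
    have h2 : ‖x‖ ^ ((p : ℤ) - (n : ℤ)) = ‖x‖ ^ ((p : ℤ) - (n : ℤ) - 1) * ‖x‖ := by
      rw [← zpow_add_one₀ (norm_ne_zero_iff.2 hx)]; congr 1; ring
    calc _ ≤ |fundCoeff n p| * ‖x‖ ^ ((p : ℤ) - (n : ℤ) - 1) * (‖vecL n‖ * ‖x‖) := by
          gcongr
      _ = _ := by rw [h2]; ring

/-! ### The Cauchy field -/

/-- The field `u ↦ ∑_j (-1)^j G_{j+1}(x - a) u D^j f(x)`, linear in the vector `u`. -/
def cauchyField (n q : ℕ) (a : E n) (f : E n → Cl n) (u x : E n) : Cl n :=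
  ∑ j ∈ Finset.range q, (-1 : ℝ) ^ j • (G n (j + 1) (x - a) * vec u * (dirac n)^[j] f x)

/-- Linearity in `u` allows the flux against the normal to be computed one coordinate direction at a
time. -/
theorem sum_smul_cauchyField {n q : ℕ} (a : E n) (f : E n → Cl n) (u x : E n) :
    ∑ i, u i • cauchyField n q a f (e n i) x = cauchyField n q a f u x := by
  simp only [cauchyField, Finset.smul_sum]
  rw [Finset.sum_comm]
  refine Finset.sum_congr rfl fun j _ => ?_
  conv_rhs => rw [← sum_smul_vec_e u]
  rw [Finset.mul_sum, Finset.sum_mul, Finset.smul_sum]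
  refine Finset.sum_congr rfl fun i _ => ?_
  rw [mul_smul_comm, smul_mul_assoc, smul_comm]

theorem sum_range_alternating {M : Type*} [AddCommGroup M] [Module ℝ M] (T : ℕ → M) (q : ℕ) :
    ∑ j ∈ Finset.range q, (-1 : ℝ) ^ j • (T j + T (j + 1)) = T 0 - (-1 : ℝ) ^ q • T q := by
  induction q with
  | zero => simp
  | succ q ih =>
    rw [Finset.sum_range_succ, ih, pow_succ, smul_add]
    simp [sub_eq_add_neg]

section Field

variable {n q : ℕ} {f : E n → Cl n} {V : Set (E n)}

theorem contDiffAt_G_sub (p : ℕ) {a x : E n} (hx : x ≠ a) {k : WithTop ℕ∞} :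
    ContDiffAt ℝ k (fun y => G n p (y - a)) x :=
  (contDiffAt_G n p (sub_ne_zero.2 hx)).comp x (contDiffAt_id.sub contDiffAt_const)

theorem contDiffAt_dirac_iterate (hV : IsOpen V) (hf : ContDiffOn ℝ q f V) {j : ℕ} (hj : j < q)
    {x : E n} (hx : x ∈ V) : ContDiffAt ℝ 1 ((dirac n)^[j] f) x :=
  ((contDiffOn_dirac_iterate hV hf hj.le).contDiffAt (hV.mem_nhds hx)).of_le
    (by exact_mod_cast (by omega : 1 ≤ q - j))

theorem contDiffAt_cauchyField (hV : IsOpen V) (hf : ContDiffOn ℝ q f V) {a x : E n} (hx : x ∈ V)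
    (hxa : x ≠ a) (u : E n) : ContDiffAt ℝ 1 (cauchyField n q a f u) x := by
  refine ContDiffAt.sum fun j hj => ?_
  refine ContDiffAt.const_smul _ (contDiffAt_mul (contDiffAt_mul (contDiffAt_G_sub _ hxa)
    contDiffAt_const) (contDiffAt_dirac_iterate hV hf (Finset.mem_range.1 hj) hx))

theorem rightDirac_comp_sub (A : E n → Cl n) (a x : E n) :
    rightDirac n (fun y => A (y - a)) x = rightDirac n A (x - a) := by
  simp only [rightDirac, fderiv_comp_sub]

/-- The term of index `j` has divergence `T j + T (j + 1)`, so the alternating sum collapses to `T 0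
- (-1)^q T q`. Here `T 0 = 0` because `G_1` is annihilated from the right away from its pole, and `T
q = 0` because `D^q f = 0`. -/
theorem sum_fderiv_cauchyField (hV : IsOpen V) (hq : q < n) (hf : ContDiffOn ℝ q f V)
    (hD : ∀ x ∈ V, (dirac n)^[q] f x = 0) {a x : E n} (hx : x ∈ V) (hxa : x ≠ a) :
    ∑ i, fderiv ℝ (cauchyField n q a f (e n i)) x (e n i) = 0 := by
  -- The value at `0` is imposed: it stands for `(G_1 D) f`, which is not `G n 0` times `f`.
  let T : ℕ → Cl n := fun j => if j = 0 then 0 else G n j (x - a) * (dirac n)^[j] f x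
  have hG : ∀ j, DifferentiableAt ℝ (fun y => G n (j + 1) (y - a)) x := fun j =>
    (contDiffAt_G_sub (k := 1) (j + 1) hxa).differentiableAt one_ne_zero
  have hDf : ∀ j ∈ Finset.range q, DifferentiableAt ℝ ((dirac n)^[j] f) x := fun j hj =>
    (contDiffAt_dirac_iterate hV hf (Finset.mem_range.1 hj) hx).differentiableAt one_ne_zero
  have hprod : ∀ j ∈ Finset.range q, ∀ u, DifferentiableAt ℝ
      (fun y => G n (j + 1) (y - a) * vec u * (dirac n)^[j] f y) x := fun j hj u =>
    (contDiffAt_mul (contDiffAt_mul (contDiffAt_G_sub (k := 1) _ hxa)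
      contDiffAt_const) (contDiffAt_dirac_iterate hV hf (Finset.mem_range.1 hj) hx)).differentiableAt
      one_ne_zero
  have hstep : ∀ j ∈ Finset.range q,
      ∑ i, fderiv ℝ (fun y => G n (j + 1) (y - a) * vec (e n i) * (dirac n)^[j] f y) x (e n i) =
        T j + T (j + 1) := by
    intro j hj
    rw [sum_fderiv_mul_vec_mul (hG j) (hDf j hj), rightDirac_comp_sub (G n (j + 1)),
      ← Function.iterate_succ_apply' (dirac n) j f]
    simp only [T, Nat.succ_ne_zero, if_false]
    congr 1
    split_ifs with h0
    · rw [h0, zero_add, rightDirac_G_one (sub_ne_zero.2 hxa), zero_mul]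
    · rw [rightDirac_G_succ (by omega) (by have := Finset.mem_range.1 hj; omega)
        (sub_ne_zero.2 hxa)]
  have hexp : ∀ i, fderiv ℝ (cauchyField n q a f (e n i)) x (e n i) =
      ∑ j ∈ Finset.range q, (-1 : ℝ) ^ j •
        fderiv ℝ (fun y => G n (j + 1) (y - a) * vec (e n i) * (dirac n)^[j] f y) x (e n i) := by
    intro i
    have : cauchyField n q a f (e n i) = fun y => ∑ j ∈ Finset.range q, (-1 : ℝ) ^ j •
        (G n (j + 1) (y - a) * vec (e n i) * (dirac n)^[j] f y) := rfl
    rw [this, fderiv_fun_sum (A := fun j y => (-1 : ℝ) ^ j •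
      (G n (j + 1) (y - a) * vec (e n i) * (dirac n)^[j] f y))
      fun j hj => (hprod j hj (e n i)).fun_const_smul _, sum_apply]
    refine Finset.sum_congr rfl fun j hj => ?_
    rw [fderiv_fun_const_smul (hprod j hj _)]
    rfl
  simp only [hexp]
  rw [Finset.sum_comm]
  calc _ = ∑ j ∈ Finset.range q, (-1 : ℝ) ^ j • (T j + T (j + 1)) :=
        Finset.sum_congr rfl fun j hj => by rw [← Finset.smul_sum, hstep j hj]
    _ = 0 := by
        rw [sum_range_alternating]
        have : T q = 0 := by
          simp only [T, hD x hx, mul_zero, ite_self]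
        rw [this]
        simp [T]

end Field

/-! ### A radial cutoff -/

/-- A smooth function equal to `1` on `(-∞, 1]` and to `0` on `[2, ∞)`. -/
def cutoff (t : ℝ) : ℝ := Real.smoothTransition (2 - t)

theorem contDiff_cutoff : ContDiff ℝ 1 cutoff :=
  (Real.smoothTransition.contDiff (n := 1)).comp (contDiff_const.sub contDiff_id)

theorem cutoff_of_le {t : ℝ} (ht : t ≤ 1) : cutoff t = 1 :=
  Real.smoothTransition.one_of_one_le (by linarith)

theorem cutoff_of_ge {t : ℝ} (ht : 2 ≤ t) : cutoff t = 0 :=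
  Real.smoothTransition.zero_of_nonpos (by linarith)

theorem hasDerivAt_cutoff (t : ℝ) : HasDerivAt cutoff (deriv cutoff t) t :=
  (contDiff_cutoff.differentiable one_ne_zero t).hasDerivAt

theorem continuous_deriv_cutoff : Continuous (deriv cutoff) :=
  contDiff_cutoff.continuous_deriv le_rfl

theorem deriv_cutoff_of_lt {t : ℝ} (ht : t < 1) : deriv cutoff t = 0 := by
  have : cutoff =ᶠ[𝓝 t] fun _ => 1 := by
    filter_upwards [Iio_mem_nhds ht] with s hs using cutoff_of_le (le_of_lt hs)
  rw [this.deriv_eq, deriv_const]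

theorem deriv_cutoff_of_gt {t : ℝ} (ht : 2 < t) : deriv cutoff t = 0 := by
  have : cutoff =ᶠ[𝓝 t] fun _ => 0 := by
    filter_upwards [Ioi_mem_nhds ht] with s hs using cutoff_of_ge (le_of_lt hs)
  rw [this.deriv_eq, deriv_const]

/-- The integrand is the derivative of `-cutoff (y²)`, which rises from `-1` to `0`. -/
theorem integral_deriv_cutoff_sq : ∫ y in Ioi (0 : ℝ), -(2 * y * deriv cutoff (y ^ 2)) = 1 := by
  have hd : ∀ y : ℝ, HasDerivAt (fun y => -cutoff (y ^ 2)) (-(2 * y * deriv cutoff (y ^ 2))) y := by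
    intro y
    have h1 : HasDerivAt (fun y : ℝ => y ^ 2) (2 * y) y := by simpa using hasDerivAt_pow 2 y
    have h2 := ((hasDerivAt_cutoff (y ^ 2)).comp y h1).neg
    convert! h2 using 1
    ring
  have hcont : Continuous fun y : ℝ => -(2 * y * deriv cutoff (y ^ 2)) := by
    have := continuous_deriv_cutoff
    fun_prop
  have hzero : ∀ y : ℝ, y ∉ Icc (-2 : ℝ) 2 → 2 < y ^ 2 := by
    intro y hy
    rw [mem_Icc, not_and_or, not_le, not_le] at hy
    rcases hy with h | h <;> nlinarith
  have hcs : HasCompactSupport fun y : ℝ => -(2 * y * deriv cutoff (y ^ 2)) := by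
    refine HasCompactSupport.intro (isCompact_Icc (a := (-2 : ℝ)) (b := 2)) fun y hy => ?_
    rw [deriv_cutoff_of_gt (hzero y hy)]; ring
  rw [integral_Ioi_of_hasDerivAt_of_tendsto' (fun x _ => hd x)
    (hcont.integrable_of_hasCompactSupport hcs).integrableOn (m := 0)]
  · rw [cutoff_of_le (by norm_num)]; ring
  · refine tendsto_const_nhds.congr' ?_
    filter_upwards [eventually_gt_atTop (2 : ℝ)] with y hy
    rw [cutoff_of_ge (by nlinarith), neg_zero]

/-- The kernel `-2 θ'(‖z‖²) G_p(z) z`, where `θ` is the cutoff. -/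
def cutoffKernel (n p : ℕ) (z : E n) : Cl n :=
  (-(2 * deriv cutoff (‖z‖ ^ 2))) • (G n p z * vec z)

theorem cutoffKernel_eq_zero {n p : ℕ} {z : E n} (hz : z ∉ Metric.closedBall (0 : E n) 2) :
    cutoffKernel n p z = 0 := by
  rw [mem_closedBall_zero_iff, not_le] at hz
  rw [cutoffKernel, deriv_cutoff_of_gt (by nlinarith)]
  simp

/-- The derivative of the cutoff vanishes on the unit ball, so the singularity of `G` at the origin
is never seen. -/
theorem continuous_cutoffKernel (n p : ℕ) : Continuous (cutoffKernel n p) := by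
  rw [continuous_iff_continuousAt]
  intro z
  by_cases hz : z = 0
  · have : cutoffKernel n p =ᶠ[𝓝 z] fun _ => 0 := by
      filter_upwards [Metric.ball_mem_nhds z one_pos] with y hy
      rw [hz, mem_ball_zero_iff] at hy
      rw [cutoffKernel, deriv_cutoff_of_lt (by nlinarith [norm_nonneg y])]
      simp
    exact continuousAt_const.congr this.symm
  · have h1 : ContinuousAt (fun z : E n => -(2 * deriv cutoff (‖z‖ ^ 2))) z := by
      have := continuous_deriv_cutoff
      exact Continuous.continuousAt (by fun_prop)
    exact h1.smul ((contDiffAt_mul (contDiffAt_G n p hz (k := 0))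
      ((vecL n).contDiff.contDiffAt)).continuousAt)

/-- Since `z z = -‖z‖²`, the product `G_1(z) z` is the scalar `‖z‖^(2-n)` off the origin. Polar
coordinates then leave the sphere area times the total drop of the cutoff. -/
theorem integral_cutoffKernel_one {n : ℕ} (hn : 1 ≤ n) :
    ∫ z, cutoffKernel n 1 z = sphereArea n • (1 : Cl n) := by
  have : Nonempty (Fin n) := ⟨⟨0, hn⟩⟩
  have hfun : cutoffKernel n 1 = fun z =>
      (-(2 * deriv cutoff (‖z‖ ^ 2)) * (‖z‖ ^ (-(n : ℤ)) * ‖z‖ ^ 2)) • (1 : Cl n) := by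
    funext z
    rw [cutoffKernel, G, if_neg (by decide), smul_mul_assoc, vec_mul_vec_self, smul_smul, smul_smul]
    congr 1
    have : ((1 : ℕ) : ℤ) - (n : ℤ) - 1 = -(n : ℤ) := by push_cast; ring
    rw [this]
    simp [fundCoeff]
    ring
  rw [hfun, integral_smul_const]
  congr 1
  rw [integral_fun_norm_addHaar (volume : Measure (E n))
    (fun r => -(2 * deriv cutoff (r ^ 2)) * (r ^ (-(n : ℤ)) * r ^ 2)), sphereArea,
    Measure.toSphere_real_apply_univ, finrank_euclideanSpace_fin]
  have : ∫ y in Ioi (0 : ℝ), y ^ (n - 1) •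
      (-(2 * deriv cutoff (y ^ 2)) * (y ^ (-(n : ℤ)) * y ^ 2)) = 1 := by
    rw [← integral_deriv_cutoff_sq]
    refine setIntegral_congr_fun measurableSet_Ioi fun y hy => ?_
    have hy0 : y ≠ 0 := ne_of_gt hy
    have h1 : y ^ n = y ^ (n - 1) * y := by
      rw [← pow_succ, Nat.sub_add_cancel hn]
    have h2 : y ^ (n - 1) ≠ 0 := pow_ne_zero _ hy0
    simp only [zpow_neg, zpow_natCast, smul_eq_mul]
    rw [h1]
    field_simp
  rw [this, nsmul_eq_mul, smul_eq_mul, mul_one]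

section Limit

variable {n : ℕ} {κ h : E n → Cl n} {V : Set (E n)} {a : E n}

theorem continuousOn_comp_scaling {ε r : ℝ} (hε : 0 < ε) (hεr : ε * 2 ≤ r)
    (hV : Metric.closedBall a r ⊆ V) (hh : ContinuousOn h V) :
    ContinuousOn (fun z => h (a + ε • z)) (Metric.closedBall 0 2) := by
  refine hh.comp (by fun_prop) fun z hz => hV ?_
  rw [mem_closedBall_zero_iff] at hz
  rw [Metric.mem_closedBall, dist_self_add_left, norm_smul, Real.norm_of_nonneg hε.le]
  nlinarith

theorem integrable_kernel_mul_scaling (hκ : Continuous κ)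
    (hκ0 : ∀ z ∉ Metric.closedBall (0 : E n) 2, κ z = 0) {ε r : ℝ} (hε : 0 < ε) (hεr : ε * 2 ≤ r)
    (hV : Metric.closedBall a r ⊆ V) (hh : ContinuousOn h V) :
    Integrable fun z => κ z * h (a + ε • z) := by
  have h1 : IntegrableOn (fun z => κ z * h (a + ε • z)) (Metric.closedBall 0 2) :=
    (continuousOn_mul hκ.continuousOn
      (continuousOn_comp_scaling hε hεr hV hh)).integrableOn_compact (isCompact_closedBall _ _)
  refine (integrableOn_iff_integrable_of_support_subset fun z hz => ?_).1 h1
  by_contra h0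
  exact hz (by simp only [hκ0 z h0, zero_mul])

theorem tendsto_integral_kernel_mul_scaling (hκ : Continuous κ)
    (hκ0 : ∀ z ∉ Metric.closedBall (0 : E n) 2, κ z = 0) {r : ℝ} (hr : 0 < r)
    (hV : Metric.closedBall a r ⊆ V) (hh : ContinuousOn h V) :
    Tendsto (fun ε : ℝ => ∫ z, κ z * h (a + ε • z)) (𝓝[>] 0) (𝓝 ((∫ z, κ z) * h a)) := by
  have hκc : HasCompactSupport κ := HasCompactSupport.intro (isCompact_closedBall 0 2) hκ0
  obtain ⟨M, hM⟩ := hκc.exists_bound_of_continuous hκ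
  have hM0 : 0 ≤ M := (norm_nonneg _).trans (hM 0)
  obtain ⟨B, hB⟩ := (isCompact_closedBall a r).exists_bound_of_continuousOn (hh.mono hV)
  have hlim : (∫ z, κ z) * h a = ∫ z, κ z * h a :=
    (((mulL n).flip (h a)).integral_comp_comm (hκ.integrable_of_hasCompactSupport hκc)).symm
  rw [hlim]
  have hsmall : ∀ᶠ ε : ℝ in 𝓝[>] 0, 0 < ε ∧ ε * 2 ≤ r := by
    filter_upwards [self_mem_nhdsWithin, mem_nhdsWithin_of_mem_nhds (Iio_mem_nhds (half_pos hr))]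
      with ε h1 h2
    have h2' : ε < r / 2 := h2
    exact ⟨h1, by linarith⟩
  refine tendsto_integral_filter_of_dominated_convergence
    ((Metric.closedBall (0 : E n) 2).indicator fun _ => ‖mulL n‖ * M * B) ?_ ?_ ?_ ?_
  · filter_upwards [hsmall] with ε hε
    exact (integrable_kernel_mul_scaling hκ hκ0 hε.1 hε.2 hV hh).1
  · filter_upwards [hsmall] with ε hε
    refine .of_forall fun z => ?_
    by_cases hz : z ∈ Metric.closedBall (0 : E n) 2
    · rw [indicator_of_mem hz]
      refine (norm_mul_le_mulL _ _).trans ?_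
      have hb : ‖h (a + ε • z)‖ ≤ B := by
        refine hB _ ?_
        rw [mem_closedBall_zero_iff] at hz
        rw [Metric.mem_closedBall, dist_self_add_left, norm_smul, Real.norm_of_nonneg hε.1.le]
        nlinarith [hε.1, hε.2]
      gcongr
      exact hM z
    · rw [indicator_of_notMem hz, hκ0 z hz, zero_mul, norm_zero]
  · exact (integrable_indicator_iff measurableSet_closedBall).2
      (integrableOn_const (isCompact_closedBall _ _).measure_lt_top.ne)
  · refine .of_forall fun z => ?_
    have hca : ContinuousAt h a :=
      hh.continuousAt (mem_of_superset (Metric.closedBall_mem_nhds a hr) hV)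
    have h1 : Tendsto (fun ε : ℝ => a + ε • z) (𝓝[>] 0) (𝓝 a) := by
      have : Continuous fun ε : ℝ => a + ε • z := by fun_prop
      have := this.tendsto 0
      rw [zero_smul, add_zero] at this
      exact this.mono_left nhdsWithin_le_nhds
    exact ((mulL n (κ z)).continuous.tendsto _).comp (hca.tendsto.comp h1)

end Limit

/-! ### The Cauchy formula on `ℝⁿ` -/

section Cauchy

variable {d q : ℕ} {f : E (d + 1) → Cl (d + 1)} {V W : Set (E (d + 1))} {a : E (d + 1)}

theorem integrable_mul_vec_outerNormal_mul (hW : IsLipschitzOpen W) (hb : Bornology.IsBounded W)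
    {A B : E (d + 1) → Cl (d + 1)} (hA : ContinuousOn A (frontier W))
    (hB : ContinuousOn B (frontier W)) :
    Integrable (fun x => A x * vec (outerNormal W x) * B x) (surfaceMeasure W) := by
  have h1 : ∀ i, Integrable (fun x => inner ℝ (e (d + 1) i) (outerNormal W x) •
      (A x * vec (e (d + 1) i) * B x)) (surfaceMeasure W) := fun i =>
    integrable_inner_outerNormal_smul hW hb
      (continuousOn_mul (continuousOn_mul hA continuousOn_const) hB) _
  have h2 := integrable_finsetSum Finset.univ fun i _ => h1 i
  refine h2.congr (.of_forall fun x => ?_)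
  simp only [inner_e]
  conv_rhs => rw [← sum_smul_vec_e (outerNormal W x)]
  rw [Finset.mul_sum, Finset.sum_mul]
  refine Finset.sum_congr rfl fun i _ => ?_
  rw [mul_smul_comm, smul_mul_assoc]

/-- The divergence theorem is applied to each coordinate field. The fields `P i` have to match the
Cauchy field on the frontier only, so it may be altered near its pole inside `W`. -/
theorem integral_cauchyField_outerNormal_eq (hW : IsLipschitzOpen W) (hb : Bornology.IsBounded W)
    (hV : IsOpen V) (hWV : closure W ⊆ V) {P : Fin (d + 1) → E (d + 1) → Cl (d + 1)}
    (hP : ∀ i, ContDiffOn ℝ 1 (P i) V)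
    (hPf : ∀ i, ∀ x ∈ frontier W, P i x = cauchyField (d + 1) q a f (e (d + 1) i) x) :
    ∫ x, cauchyField (d + 1) q a f (outerNormal W x) x ∂(surfaceMeasure W) =
      ∫ x in W, ∑ i, fderiv ℝ (P i) x (e (d + 1) i) := by
  have h1 := fun i => setIntegral_fderiv_eq_surface hW hb hV hWV (hP i) (e (d + 1) i)
  rw [integral_finsetSum _ fun i _ => (h1 i).1, Finset.sum_congr rfl fun i _ => (h1 i).2,
    ← integral_finsetSum _ fun i _ => integrable_inner_outerNormal_smul hW hb
      ((hP i).continuousOn.mono (frontier_subset_closure.trans hWV)) _]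
  refine setIntegral_congr_fun isClosed_frontier.measurableSet fun x hx => ?_
  simp only [inner_e]
  rw [← sum_smul_cauchyField]
  exact Finset.sum_congr rfl fun i _ => by rw [hPf i x hx]

theorem integral_cauchyField_of_notMem (hW : IsLipschitzOpen W) (hb : Bornology.IsBounded W)
    (hV : IsOpen V) (hWV : closure W ⊆ V) (hq : q < d + 1) (hf : ContDiffOn ℝ q f V)
    (hD : ∀ x ∈ V, (dirac (d + 1))^[q] f x = 0) (ha : a ∉ closure W) :
    ∫ x, cauchyField (d + 1) q a f (outerNormal W x) x ∂(surfaceMeasure W) = 0 := by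
  rw [integral_cauchyField_outerNormal_eq hW hb (V := V ∩ {x | x ≠ a})
    (hV.inter isOpen_ne) (P := fun i => cauchyField (d + 1) q a f (e (d + 1) i))
    (hWV := fun x hx => ⟨hWV hx, ne_of_mem_of_not_mem hx ha⟩)
    (hP := fun i x hx => (contDiffAt_cauchyField hV hf hx.1 hx.2 _).contDiffWithinAt)
    (hPf := fun i x _ => rfl)]
  refine setIntegral_eq_zero_of_forall_eq_zero fun x hx => ?_
  exact sum_fderiv_cauchyField hV hq hf hD (hWV (subset_closure hx))
    (ne_of_mem_of_not_mem (subset_closure hx) ha)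

theorem hasFDerivAt_cutoff_scaled (a x : E (d + 1)) (ε : ℝ) :
    HasFDerivAt (fun y => 1 - cutoff (‖y - a‖ ^ 2 / ε ^ 2))
      ((-(2 / ε ^ 2 * deriv cutoff (‖x - a‖ ^ 2 / ε ^ 2))) • innerSL ℝ (x - a)) x := by
  have h1 : HasFDerivAt (fun y => ‖y - a‖ ^ 2) (2 • innerSL ℝ (x - a)) x := by
    have := ((hasFDerivAt_id x).sub_const a).norm_sq
    simpa using this
  have h2 : HasFDerivAt (fun y => ‖y - a‖ ^ 2 / ε ^ 2) ((ε ^ 2)⁻¹ • (2 • innerSL ℝ (x - a))) x := by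
    simpa [div_eq_inv_mul] using h1.const_mul (ε ^ 2)⁻¹
  have h3 := ((hasDerivAt_cutoff (‖x - a‖ ^ 2 / ε ^ 2)).comp_hasFDerivAt x h2).const_sub 1
  refine h3.congr_fderiv ?_
  ext u
  simp
  ring

/-- The field is multiplied by a radial function that vanishes near `a` and equals `1` outside `W`,
so its flux is unchanged. Its own divergence being zero, only the gradient of the cutoff remains,
which replaces the normal by a multiple of `x - a`. The substitution `x = a + ε z` moves the
dependence on `ε` into explicit powers and the argument of `f`. -/
theorem integral_cauchyField_eq_sum_scaled (hW : IsLipschitzOpen W) (hb : Bornology.IsBounded W)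
    (hV : IsOpen V) (hWV : closure W ⊆ V) (hq : q < d + 1) (hf : ContDiffOn ℝ q f V)
    (hD : ∀ x ∈ V, (dirac (d + 1))^[q] f x = 0) {r : ℝ} (hr : Metric.closedBall a r ⊆ W)
    {ε : ℝ} (hε : 0 < ε) (hεr : ε * 2 ≤ r) :
    ∫ x, cauchyField (d + 1) q a f (outerNormal W x) x ∂(surfaceMeasure W) =
      ∑ j ∈ Finset.range q, ((-1 : ℝ) ^ j * ε ^ j) •
        ∫ z, cutoffKernel (d + 1) (j + 1) z * (dirac (d + 1))^[j] f (a + ε • z) := by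
  have haW : a ∈ W := hr (Metric.mem_closedBall_self (by linarith))
  have hVW : W ⊆ V := subset_closure.trans hWV
  have hfar : ∀ x ∉ W, 2 < ‖x - a‖ ^ 2 / ε ^ 2 := by
    intro x hx
    have h1 : r < ‖x - a‖ := by
      by_contra h
      exact hx (hr (by rw [Metric.mem_closedBall, dist_eq_norm]; exact not_lt.1 h))
    rw [lt_div_iff₀ (by positivity)]
    nlinarith
  have hnear : ∀ᶠ y in 𝓝 a, ‖y - a‖ ^ 2 / ε ^ 2 ≤ 1 := by
    filter_upwards [Metric.ball_mem_nhds a hε] with y hy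
    rw [Metric.mem_ball, dist_eq_norm] at hy
    rw [div_le_one (by positivity)]
    gcongr
  let P : Fin (d + 1) → E (d + 1) → Cl (d + 1) := fun i x =>
    (1 - cutoff (‖x - a‖ ^ 2 / ε ^ 2)) • cauchyField (d + 1) q a f (e (d + 1) i) x
  have hPa : ∀ i, P i =ᶠ[𝓝 a] fun _ => 0 := by
    intro i
    filter_upwards [hnear] with y hy
    simp only [P]
    rw [cutoff_of_le hy, sub_self, zero_smul]
  have hcs : ContDiff ℝ 1 fun y : E (d + 1) => 1 - cutoff (‖y - a‖ ^ 2 / ε ^ 2) :=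
    contDiff_const.sub (contDiff_cutoff.comp
      (((contDiff_id.sub contDiff_const).norm_sq ℝ).div_const _))
  have hP : ∀ i, ContDiffOn ℝ 1 (P i) V := by
    intro i x hx
    by_cases hxa : x = a
    · rw [hxa]
      exact (contDiffAt_const.congr_of_eventuallyEq (hPa i)).contDiffWithinAt
    · exact (hcs.contDiffAt.smul (contDiffAt_cauchyField hV hf hx hxa _)).contDiffWithinAt
  let Q : E (d + 1) → Cl (d + 1) := fun x =>
    (-(2 / ε ^ 2 * deriv cutoff (‖x - a‖ ^ 2 / ε ^ 2))) • cauchyField (d + 1) q a f (x - a) x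
  have hdiv : ∀ x ∈ W, ∑ i, fderiv ℝ (P i) x (e (d + 1) i) = Q x := by
    intro x hx
    by_cases hxa : x = a
    · have h1 : ∀ i, fderiv ℝ (P i) x (e (d + 1) i) = 0 := fun i => by
        rw [hxa, (hPa i).fderiv_eq]; simp
      have h2 : deriv cutoff (‖x - a‖ ^ 2 / ε ^ 2) = 0 := deriv_cutoff_of_lt (by rw [hxa]; simp)
      simp [h1, Q, h2]
    · have h1 : ∀ i, fderiv ℝ (P i) x (e (d + 1) i) =
          (1 - cutoff (‖x - a‖ ^ 2 / ε ^ 2)) •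
            fderiv ℝ (cauchyField (d + 1) q a f (e (d + 1) i)) x (e (d + 1) i) +
          (-(2 / ε ^ 2 * deriv cutoff (‖x - a‖ ^ 2 / ε ^ 2))) •
            ((x - a) i • cauchyField (d + 1) q a f (e (d + 1) i) x) := by
        intro i
        have hd := (hasFDerivAt_cutoff_scaled a x ε).fun_smul
          ((contDiffAt_cauchyField hV hf (hVW hx) hxa (e (d + 1) i)).differentiableAt
            one_ne_zero).hasFDerivAt
        simp only [P]
        rw [hd.fderiv]
        simp only [add_apply, smul_apply, ContinuousLinearMap.smulRight_apply, innerSL_apply_apply,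
          smul_eq_mul]
        rw [real_inner_comm, inner_e, smul_smul]
      simp only [h1]
      rw [Finset.sum_add_distrib, ← Finset.smul_sum, ← Finset.smul_sum,
        sum_fderiv_cauchyField hV hq hf hD (hVW hx) hxa, smul_zero, zero_add, sum_smul_cauchyField]
  rw [integral_cauchyField_outerNormal_eq hW hb hV hWV hP, setIntegral_congr_fun
    hW.1.measurableSet hdiv, setIntegral_eq_integral_of_forall_compl_eq_zero]
  · have hscale : ∫ x, Q x = ε ^ (d + 1) • ∫ z, Q (a + ε • z) := by
      rw [Measure.integral_comp_smul volume (fun z => Q (a + z)), finrank_euclideanSpace_fin,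
        integral_add_left_eq_self Q a, smul_smul, abs_of_pos (by positivity),
        mul_inv_cancel₀ (by positivity), one_smul]
    rw [hscale, ← integral_smul]
    -- With `n = d + 1`, the powers are `ε^n` from the volume, `ε^(-2)` from the cutoff, `ε^(j+1-n)`
    -- from the homogeneity of `G_{j+1}` and `ε` from the vector `x - a`; their product is `ε^j`.
    have hQ : ∀ z, ε ^ (d + 1) • Q (a + ε • z) = ∑ j ∈ Finset.range q, ((-1 : ℝ) ^ j * ε ^ j) •
        (cutoffKernel (d + 1) (j + 1) z * (dirac (d + 1))^[j] f (a + ε • z)) := by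
      intro z
      simp only [Q, cauchyField, cutoffKernel]
      rw [add_sub_cancel_left, norm_smul, Real.norm_of_nonneg hε.le, mul_pow,
        mul_div_cancel_left₀ _ (by positivity), smul_smul, Finset.smul_sum]
      refine Finset.sum_congr rfl fun j _ => ?_
      rw [G_smul _ _ hε, vec, map_smul, smul_mul_smul_comm, smul_mul_assoc, smul_mul_assoc, smul_smul,
        smul_smul, smul_smul]
      congr 1
      have h1 : ε ^ (((j + 1 : ℕ) : ℤ) - ((d + 1 : ℕ) : ℤ)) = ε ^ j * ε / ε ^ (d + 1) := by
        rw [zpow_sub₀ hε.ne', zpow_natCast, zpow_natCast, pow_succ]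
      rw [h1]
      field_simp
    simp only [hQ]
    rw [integral_finsetSum]
    · exact Finset.sum_congr rfl fun j _ => integral_smul _ _
    · intro j hj
      exact Integrable.smul ((-1 : ℝ) ^ j * ε ^ j)
        (integrable_kernel_mul_scaling (continuous_cutoffKernel _ _)
          (fun z => cutoffKernel_eq_zero) hε hεr (hr.trans hVW)
          (contDiffOn_dirac_iterate hV hf (Finset.mem_range.1 hj).le).continuousOn)
  · intro x hx
    simp only [Q]
    rw [deriv_cutoff_of_gt (hfar x hx)]
    simp
  · intro i x hx
    have hxW : x ∉ W := by rw [hW.1.frontier_eq] at hx; exact hx.2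
    simp only [P]
    rw [cutoff_of_ge (hfar x hxW).le, sub_zero, one_smul]

/-- The scaled expression is constant in small `ε > 0`, hence equal to its limit. The factors `ε^j`
remove every term with `j ≥ 1`, and the term `j = 0` is the kernel mass `ω_n` times `f a`. -/
theorem integral_cauchyField_of_mem (hW : IsLipschitzOpen W) (hb : Bornology.IsBounded W)
    (hV : IsOpen V) (hWV : closure W ⊆ V) (hq1 : 1 ≤ q) (hq : q < d + 1) (hf : ContDiffOn ℝ q f V)
    (hD : ∀ x ∈ V, (dirac (d + 1))^[q] f x = 0) (ha : a ∈ W) :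
    ∫ x, cauchyField (d + 1) q a f (outerNormal W x) x ∂(surfaceMeasure W) =
      sphereArea (d + 1) • f a := by
  obtain ⟨r, hr0, hr⟩ := Metric.nhds_basis_closedBall.mem_iff.1 (hW.1.mem_nhds ha)
  have hlim : Tendsto (fun ε : ℝ => ∑ j ∈ Finset.range q, ((-1 : ℝ) ^ j * ε ^ j) •
        ∫ z, cutoffKernel (d + 1) (j + 1) z * (dirac (d + 1))^[j] f (a + ε • z)) (𝓝[>] 0)
      (𝓝 (∑ j ∈ Finset.range q, ((-1 : ℝ) ^ j * 0 ^ j) •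
        ((∫ z, cutoffKernel (d + 1) (j + 1) z) * (dirac (d + 1))^[j] f a))) := by
    refine tendsto_finsetSum _ fun j hj => Tendsto.smul ?_ ?_
    · have : Continuous fun ε : ℝ => (-1 : ℝ) ^ j * ε ^ j := by fun_prop
      exact (this.tendsto 0).mono_left nhdsWithin_le_nhds
    · exact tendsto_integral_kernel_mul_scaling (continuous_cutoffKernel _ _)
        (fun z => cutoffKernel_eq_zero) hr0 (hr.trans (subset_closure.trans hWV))
        (contDiffOn_dirac_iterate hV hf (Finset.mem_range.1 hj).le).continuousOn
  have hconst : Tendsto (fun _ : ℝ => ∫ x, cauchyField (d + 1) q a f (outerNormal W x) x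
      ∂(surfaceMeasure W)) (𝓝[>] 0) (𝓝 (∑ j ∈ Finset.range q, ((-1 : ℝ) ^ j * 0 ^ j) •
        ((∫ z, cutoffKernel (d + 1) (j + 1) z) * (dirac (d + 1))^[j] f a))) := by
    refine hlim.congr' ?_
    filter_upwards [self_mem_nhdsWithin, mem_nhdsWithin_of_mem_nhds (Iio_mem_nhds (half_pos hr0))]
      with ε h1 h2
    have h2' : ε < r / 2 := h2
    exact (integral_cauchyField_eq_sum_scaled hW hb hV hWV hq hf hD hr h1 (by linarith)).symm
  rw [tendsto_nhds_unique tendsto_const_nhds hconst, Finset.sum_eq_single 0]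
  · simp [integral_cutoffKernel_one]
  · intro j _ hj
    rw [zero_pow hj, mul_zero, zero_smul]
  · intro h
    exact absurd (Finset.mem_range.2 hq1) h

end Cauchy

/-! ### Sums over the lattice -/

theorem norm_le_norm_latticeVec {n k : ℕ} (hk : k ≤ n) (m : Fin k → ℤ) :
    ‖m‖ ≤ ‖latticeVec n k m‖ := by
  refine (pi_norm_le_iff_of_nonneg (norm_nonneg _)).2 fun i => ?_
  have h := PiLp.norm_apply_le (latticeVec n k m) ⟨i, i.2.trans_le hk⟩
  have hval : (latticeVec n k m) ⟨i, i.2.trans_le hk⟩ = (m i : ℝ) := by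
    simp [latticeVec]
  rw [hval] at h
  rwa [Int.norm_eq_abs]

theorem latticeVec_eq_zero {n k : ℕ} (hk : k ≤ n) {m : Fin k → ℤ} (h : latticeVec n k m = 0) :
    m = 0 := by
  have := norm_le_norm_latticeVec hk m
  rw [h, norm_zero] at this
  exact norm_le_zero_iff.1 this

theorem norm_sign (k l : ℕ) (m : Fin k → ℤ) : ‖sign k l m‖ = 1 := by
  rw [sign, norm_zpow]; simp

/-- The integer points form a lattice of rank `k` in `ℝᵏ` with the sup norm, and inverse powers of
exponent above the rank are summable over a lattice. -/
theorem summable_norm_inv_pow_int {k N : ℕ} (h : k < N) :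
    Summable fun m : Fin k → ℤ => ‖m‖⁻¹ ^ N := by
  let b := Pi.basisFun ℝ (Fin k)
  let L := Submodule.span ℤ (range b)
  have hrank : finrank ℤ L = k := by
    rw [finrank_eq_card_basis (b.restrictScalars ℤ)]; simp
  have hs := ZLattice.summable_norm_pow_inv L N (by rw [hrank]; exact h)
  let ι : (Fin k → ℤ) → L := fun m => ∑ i, m i • (b.restrictScalars ℤ i)
  have hι : ∀ m, ((ι m : L) : Fin k → ℝ) = fun i => (m i : ℝ) := by
    intro m
    funext i
    simp [ι, b, Pi.single_apply]
  have hinj : Function.Injective ι := by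
    intro m m' hmm
    have := congrArg (fun z : L => (z : Fin k → ℝ)) hmm
    simp only [hι] at this
    funext i
    exact_mod_cast congrFun this i
  refine (hs.comp_injective hinj).congr fun m => ?_
  have : ‖ι m‖ = ‖m‖ := by
    rw [Submodule.coe_norm, hι]
    simp only [Pi.norm_def]
    congr 2
  simp only [Function.comp_apply, this]

theorem eventually_le_norm_int (k : ℕ) (R : ℝ) : ∀ᶠ m : Fin k → ℤ in cofinite, R ≤ ‖m‖ := by
  have := tendsto_norm_cocompact_atTop (E := Fin k → ℤ)
  rw [cocompact_eq_cofinite] at this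
  exact this.eventually_ge_atTop R

/-- A Weierstrass majorant. For large `m` the growth of `G` gives a bound of order `‖m‖^(p-n)`,
summable as `n - p > k`. The finitely many remaining terms are bounded by compactness, since no pole
lies on `S`. -/
theorem exists_summable_bound_cotTerm {n p k : ℕ} (l : ℕ) (hp : k + p < n) {S : Set (E n)}
    (hS : IsCompact S) {y : E n} (hy : ∀ x ∈ S, ∀ m, x - y + latticeVec n k m ≠ 0) :
    (∀ m, ContinuousOn (fun x => cotTerm n p k l x y m) S) ∧
    ∃ u : (Fin k → ℤ) → ℝ, Summable u ∧ ∀ m, ∀ x ∈ S, ‖cotTerm n p k l x y m‖ ≤ u m := by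
  have hcont : ∀ m, ContinuousOn (fun x => cotTerm n p k l x y m) S := by
    intro m x hx
    have h1 : ContinuousAt (fun x => x - y + latticeVec n k m) x := by fun_prop
    have h2 : ContinuousAt (G n p) (x - y + latticeVec n k m) :=
      (contDiffAt_G n p (hy x hx m) (k := 0)).continuousAt
    exact ((ContinuousAt.comp (f := fun x => x - y + latticeVec n k m) h2 h1).const_smul
      (sign k l m)).continuousWithinAt
  refine ⟨hcont, ?_⟩
  choose M hM using fun m => hS.exists_bound_of_continuousOn (hcont m)
  obtain ⟨C, hC0, hC⟩ := exists_norm_G_le n p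
  obtain ⟨R, hR⟩ := (hS.image (continuous_sub_right y)).isBounded.exists_norm_le
  classical
  -- `‖m‖ ≥ 2R` forces `‖x - y + m‖ ≥ ‖m‖ / 2`, and `‖m‖ ≥ 1` makes the inverse power meaningful.
  set R' := max (2 * R) 1
  let b : (Fin k → ℤ) → ℝ := fun m => C * 2 ^ (n - p) * ‖m‖⁻¹ ^ (n - p)
  refine ⟨fun m => if R' ≤ ‖m‖ then b m else M m, ?_, fun m x hx => ?_⟩
  · have hb : Summable b := (summable_norm_inv_pow_int (by omega)).mul_left _
    refine hb.congr_cofinite ?_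
    filter_upwards [eventually_le_norm_int k R'] with m hm
    rw [if_pos hm]
  · beta_reduce
    split_ifs with hm
    · have h1 : ‖x - y‖ ≤ R := hR _ ⟨x, hx, rfl⟩
      have h2 : 2 * R ≤ ‖m‖ := (le_max_left _ _).trans hm
      have h3 : 0 < ‖m‖ := lt_of_lt_of_le one_pos ((le_max_right _ _).trans hm)
      have h4 := norm_le_norm_latticeVec (by omega : k ≤ n) m
      have h5 : ‖m‖ / 2 ≤ ‖x - y + latticeVec n k m‖ := by
        have := norm_sub_le (x - y + latticeVec n k m) (x - y)
        rw [add_sub_cancel_left] at this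
        linarith
      have h6 : ‖x - y + latticeVec n k m‖ ^ ((p : ℤ) - (n : ℤ)) ≤ 2 ^ (n - p) * ‖m‖⁻¹ ^ (n - p) := by
        have : (p : ℤ) - (n : ℤ) = -((n - p : ℕ) : ℤ) := by omega
        rw [this, zpow_neg, zpow_natCast, ← mul_pow, ← inv_pow]
        gcongr
        rw [← div_eq_mul_inv, ← inv_div]
        gcongr
      rw [cotTerm, norm_smul, norm_sign, one_mul]
      refine (hC _ (hy x hx m)).trans ?_
      simp only [b]
      rw [mul_assoc]
      gcongr
    · exact hM m x hx

/-! ### Lifts of sections -/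

theorem isOpen_cover (n k : ℕ) {V' : Set (Cylinder n k)} (hV' : IsOpen V') :
    IsOpen (cover n k V') := hV'.preimage QuotientAddGroup.continuous_mk

/-- Two representatives over the same base point differ by a lattice vector equal to zero, so the
fibre identification is trivial. Regularity known for one lift thus passes to every lift. -/
theorem IsLift.eqOn {n k l : ℕ} (hk : k ≤ n) {V' : Set (Cylinder n k)}
    {s : V' → SpinorBundle n k l} {f g : E n → Cl n} (hf : IsLift n k l V' s f)
    (hg : IsLift n k l V' s g) : EqOn f g (cover n k V') := by
  intro x hx
  have h1 : SpinorBundle.mk n k l x (f x) = SpinorBundle.mk n k l x (g x) :=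
    (hf x hx).symm.trans (hg x hx)
  obtain ⟨m, hm1, hm2⟩ := Quotient.exact h1
  have hm : m = 0 := latticeVec_eq_zero hk (left_eq_add.1 hm1)
  rw [hm, CliffordCylinder.sign_zero, one_smul] at hm2
  exact hm2.symm

/-! ### Translates of a fundamental domain -/

section Translates

variable {n k : ℕ} {W : Set (E n)} {y : E n}

/-- The translate `W - m` is an open neighbourhood of `y - m`. If that point were in the closure of
`W`, the two sets would meet, giving congruent points of `W`. -/
theorem sub_latticeVec_notMem_closure (hW : IsOpen W)
    (hcong : ∀ x ∈ W, ∀ m : Fin k → ℤ, m ≠ 0 → x + latticeVec n k m ∉ W) (hy : y ∈ W)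
    {m : Fin k → ℤ} (hm : m ≠ 0) : y - latticeVec n k m ∉ closure W := by
  intro h
  have hopen : IsOpen {x | x + latticeVec n k m ∈ W} := hW.preimage (by fun_prop)
  obtain ⟨w, hw1, hw2⟩ := mem_closure_iff.1 h _ hopen (by simpa using hy)
  exact hcong w hw2 m hm hw1

theorem sub_add_latticeVec_ne_zero (hW : IsOpen W)
    (hcong : ∀ x ∈ W, ∀ m : Fin k → ℤ, m ≠ 0 → x + latticeVec n k m ∉ W) (hy : y ∈ W) {x : E n}
    (hx : x ∈ frontier W) (m : Fin k → ℤ) : x - y + latticeVec n k m ≠ 0 := by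
  intro h
  have hxy : x = y - latticeVec n k m := by
    rw [eq_sub_iff_add_eq, ← sub_eq_zero, ← h]; abel
  by_cases hm : m = 0
  · rw [hm, map_zero, sub_zero] at hxy
    rw [hxy, hW.frontier_eq] at hx
    exact hx.2 hy
  · exact sub_latticeVec_notMem_closure hW hcong hy hm (hxy ▸ frontier_subset_closure hx)

end Translates

end CliffordCylinder

end

/-! ### The Cauchy formula on the cylinder -/

open MeasureTheory CliffordCylinder
theorem theorem1 (n k l q : ℕ) (hq : 1 ≤ q) (hkq : k + q < n) (hl : l ≤ k)
    (V' : Set (Cylinder n k)) (hV' : IsOpen V')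
    (s : V' → SpinorBundle n k l) (hs : IsCliffordHolomorphicSection n k l q V' s)
    (f : E n → Cl n) (hf : IsLift n k l V' s f)
    (W : Set (E n)) (hW : IsLipschitzOpen W) (hWb : Bornology.IsBounded W)
    (hWV : closure W ⊆ cover n k V')
    (hcong : ∀ x ∈ W, ∀ m : Fin k → ℤ, m ≠ 0 → x + latticeVec n k m ∉ W)
    (y : E n) (hy : y ∈ W) :
    (∀ j < q, ∀ x ∈ frontier W, Summable (cotTerm n (j + 1) k l x y)) ∧
    Integrable (fun x => ∑ j ∈ Finset.range q, (-1 : ℝ) ^ j •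
      (cot n (j + 1) k l x y * vec (outerNormal W x) * (dirac n)^[j] f x)) (surfaceMeasure W) ∧
    f y = (1 / sphereArea n) • ∫ x, ∑ j ∈ Finset.range q, (-1 : ℝ) ^ j •
      (cot n (j + 1) k l x y * vec (outerNormal W x) * (dirac n)^[j] f x) ∂(surfaceMeasure W) := by
  obtain ⟨d, rfl⟩ : ∃ d, n = d + 1 := ⟨n - 1, by omega⟩
  have hVo := isOpen_cover (d + 1) k hV'
  obtain ⟨g, hg, hgc, hgD⟩ := hs
  have hfg : Set.EqOn f g (cover (d + 1) k V') := hf.eqOn (by omega) hg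
  have hfc : ContDiffOn ℝ q f (cover (d + 1) k V') := hgc.congr hfg
  have hfD : ∀ x ∈ cover (d + 1) k V', (dirac (d + 1))^[q] f x = 0 := fun x hx => by
    rw [dirac_iterate_congr hVo hfg q hx, hgD x hx]
  have hScpt := isCompact_frontier_of_isBounded hWb
  have hSm : MeasurableSet (frontier W) := isClosed_frontier.measurableSet
  have hbound := fun j : Fin q => exists_summable_bound_cotTerm (p := j + 1) l
    (by omega : k + (j + 1) < d + 1) hScpt
    (fun x hx m => sub_add_latticeVec_ne_zero hW.1 hcong hy hx m)
  choose hcont u hu hub using hbound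
  have hsum : ∀ j < q, ∀ x ∈ frontier W, Summable (cotTerm (d + 1) (j + 1) k l x y) :=
    fun j hj x hx => Summable.of_norm_bounded (hu ⟨j, hj⟩) fun m => hub ⟨j, hj⟩ m x hx
  have hDcont : ∀ j < q, ContinuousOn ((dirac (d + 1))^[j] f) (frontier W) := fun j hj =>
    ((contDiffOn_dirac_iterate hVo hfc hj.le).continuousOn).mono
      (frontier_subset_closure.trans hWV)
  have hcot : ∀ j < q, ContinuousOn (fun x => cot (d + 1) (j + 1) k l x y) (frontier W) :=
    fun j hj => continuousOn_tsum (hcont ⟨j, hj⟩) (hu ⟨j, hj⟩) (hub ⟨j, hj⟩)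
  refine ⟨hsum, ?_, ?_⟩
  · exact integrable_finsetSum _ fun j hj => Integrable.smul ((-1 : ℝ) ^ j)
      (integrable_mul_vec_outerNormal_mul hW hWb (hcot j (Finset.mem_range.1 hj))
        (hDcont j (Finset.mem_range.1 hj)))
  · have hfin := isFiniteMeasure_surfaceMeasure hW hWb
    -- The integrand is split over both the order `j` and the lattice, so that integration can be
    -- performed for each `m` before summing.
    let T : ℕ → (Fin k → ℤ) → E (d + 1) → Cl (d + 1) := fun j m x => (-1 : ℝ) ^ j •
      (cotTerm (d + 1) (j + 1) k l x y m * vec (outerNormal W x) * (dirac (d + 1))^[j] f x)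
    have hTint : ∀ j < q, ∀ m, Integrable (T j m) (surfaceMeasure W) := fun j hj m =>
      Integrable.smul ((-1 : ℝ) ^ j)
        (integrable_mul_vec_outerNormal_mul hW hWb (hcont ⟨j, hj⟩ m) (hDcont j hj))
    -- Exchange of the lattice sum and the surface integral: the uniform majorant on the compact
    -- frontier and the finite surface measure make the integrals of the norms summable.
    have hTsum : ∀ j < q, HasSum (fun m => ∫ x, T j m x ∂(surfaceMeasure W))
        (∫ x, (-1 : ℝ) ^ j • (cot (d + 1) (j + 1) k l x y * vec (outerNormal W x) *
          (dirac (d + 1))^[j] f x) ∂(surfaceMeasure W)) := by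
      intro j hj
      obtain ⟨B, hB⟩ := hScpt.exists_bound_of_continuousOn (hDcont j hj)
      set c := ‖mulL (d + 1)‖
      have hTb : ∀ m, ∀ x ∈ frontier W,
          ‖T j m x‖ ≤ u ⟨j, hj⟩ m * (c * c * ‖vecL (d + 1)‖ * B) := by
        intro m x hx
        have h1 : ‖vec (outerNormal W x)‖ ≤ ‖vecL (d + 1)‖ * 1 :=
          ((vecL (d + 1)).le_opNorm _).trans (by gcongr; exact norm_outerNormal_le W x)
        have h2 := hub ⟨j, hj⟩ m x hx
        have hu0 : 0 ≤ u ⟨j, hj⟩ m := (norm_nonneg _).trans h2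
        have h3 : ‖cotTerm (d + 1) (j + 1) k l x y m * vec (outerNormal W x)‖ ≤
            c * u ⟨j, hj⟩ m * (‖vecL (d + 1)‖ * 1) :=
          (norm_mul_le_mulL _ _).trans (by gcongr)
        have h4 := norm_mul_le_mulL (cotTerm (d + 1) (j + 1) k l x y m * vec (outerNormal W x))
          ((dirac (d + 1))^[j] f x)
        simp only [T]
        rw [norm_smul, norm_pow, norm_neg, norm_one, one_pow, one_mul]
        refine h4.trans ?_
        calc _ ≤ c * (c * u ⟨j, hj⟩ m * (‖vecL (d + 1)‖ * 1)) * B := by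
              gcongr
              exact hB x hx
          _ = _ := by ring
      have hsumm : Summable fun m => ∫ x, ‖T j m x‖ ∂(surfaceMeasure W) := by
        refine Summable.of_nonneg_of_le (fun m => integral_nonneg fun x => norm_nonneg _)
          (fun m => ?_) (((hu ⟨j, hj⟩).mul_right (c * c * ‖vecL (d + 1)‖ * B)).mul_left
            ((surfaceMeasure W).real Set.univ))
        calc ∫ x, ‖T j m x‖ ∂(surfaceMeasure W)
            ≤ ∫ _, u ⟨j, hj⟩ m * (c * c * ‖vecL (d + 1)‖ * B) ∂(surfaceMeasure W) :=
              integral_mono_ae (hTint j hj m).norm (integrable_const _)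
                ((ae_restrict_mem hSm).mono fun x hx => hTb m x hx)
          _ = _ := by rw [integral_const, smul_eq_mul]
      have h := hasSum_integral_of_summable_integral_norm (fun m => hTint j hj m) hsumm
      convert! h using 1
      refine setIntegral_congr_fun hSm fun x hx => ?_
      have h1 := (hsum j hj x hx).hasSum
      have h2 : HasSum (fun m => T j m x) ((-1 : ℝ) ^ j • (cot (d + 1) (j + 1) k l x y *
          vec (outerNormal W x) * (dirac (d + 1))^[j] f x)) := by
        -- For fixed `x` the integrand depends on the kernel value through a continuous linear map,
        -- which commutes with the sum over the lattice.
        let Λ := ((-1 : ℝ) ^ j) • (((mulL (d + 1)).flip ((dirac (d + 1))^[j] f x)).comp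
          ((mulL (d + 1)).flip (vec (outerNormal W x))))
        exact Λ.hasSum h1
      exact h2.tsum_eq.symm
    -- For fixed `m`, the sum over `j` is `sign k l m` times the flux of the Cauchy field with pole
    -- `y - m`. The pole is in `W` for `m = 0`, where the sign is `1`, and outside `closure W` for
    -- every other `m`.
    have hterm : ∀ m : Fin k → ℤ, ∑ j ∈ Finset.range q, ∫ x, T j m x ∂(surfaceMeasure W) =
        if m = 0 then sphereArea (d + 1) • f y else 0 := by
      intro m
      rw [← integral_finsetSum _ fun j hj => hTint j (Finset.mem_range.1 hj) m]
      have hfield : ∀ x, ∑ j ∈ Finset.range q, T j m x = sign k l m •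
          cauchyField (d + 1) q (y - latticeVec (d + 1) k m) f (outerNormal W x) x := by
        intro x
        simp only [T, cauchyField, CliffordCylinder.cotTerm, Finset.smul_sum]
        refine Finset.sum_congr rfl fun j _ => ?_
        rw [smul_mul_assoc, smul_mul_assoc, smul_comm, sub_sub_eq_add_sub, sub_add_eq_add_sub]
      simp only [hfield]
      rw [integral_smul]
      split_ifs with hm
      · rw [hm, CliffordCylinder.sign_zero, one_smul, map_zero, sub_zero]
        exact integral_cauchyField_of_mem hW hWb hVo hWV hq (by omega) hfc hfD hy
      · rw [integral_cauchyField_of_notMem hW hWb hVo hWV (by omega) hfc hfD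
          (sub_latticeVec_notMem_closure hW.1 hcong hy hm), smul_zero]
    have htotal := hasSum_sum fun j (hj : j ∈ Finset.range q) => hTsum j (Finset.mem_range.1 hj)
    simp only [hterm] at htotal
    have hsplit : ∫ x, ∑ j ∈ Finset.range q, (-1 : ℝ) ^ j • (cot (d + 1) (j + 1) k l x y *
          vec (outerNormal W x) * (dirac (d + 1))^[j] f x) ∂(surfaceMeasure W) =
        ∑ j ∈ Finset.range q, ∫ x, (-1 : ℝ) ^ j • (cot (d + 1) (j + 1) k l x y *
          vec (outerNormal W x) * (dirac (d + 1))^[j] f x) ∂(surfaceMeasure W) :=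
      integral_finsetSum _ fun j hj => Integrable.smul ((-1 : ℝ) ^ j)
        (integrable_mul_vec_outerNormal_mul hW hWb (hcot j (Finset.mem_range.1 hj))
          (hDcont j (Finset.mem_range.1 hj)))
    rw [hsplit, htotal.unique (hasSum_ite_eq 0 (sphereArea (d + 1) • f y)), smul_smul]
    have hpos : sphereArea (d + 1) ≠ 0 := by
      rw [sphereArea, Measure.toSphere_real_apply_univ, finrank_euclideanSpace_fin]
      refine mul_ne_zero (by positivity) ?_
      exact (ENNReal.toReal_pos (Metric.measure_ball_pos volume 0 one_pos).ne'
        measure_ball_lt_top.ne).ne'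
    rw [one_div, inv_mul_cancel₀ hpos, one_smul]
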